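/- Let $\mathfrak H$ be a complex separable Hilbert space and let $Z=\{Z(h):h\in\mathfrak H\}$ be a complex Gaussian isonormal process over $\mathfrak H$ on a probability space $(\Omega,\mathcal F,P)$, that is, a jointly Gaussian centred family of complex random variables with $E[Z(h)^2]=0$ and $E[Z(g)\overline{Z(h)}]=\langle g,h\rangle_{\mathfrak H}$ for all $g,h\in\mathfrak H$. Let $p,q\ge 0$ be integers with $p+q\ge 1$. Let $J_{m,n}(z)=\sum_{r=0}^{m\wedge n}(-1)^r r!\binom mr\binom nr z^{m-r}\bar z^{\,n-r}2^r$ be the complex Hermite polynomials, and let $\{e_k\}$ be a complete orthonormal system of $\mathfrak H$. For $f=\sum_{j,l}a_{j,l}\,e_{j_1}\otimes\cdots\otimes e_{j_p}\otimes\bar e_{l_1}\otimes\cdots\otimes\bar e_{l_q}$ in the Hilbert space tensor product $\mathfrak H^{\otimes p}\otimes\overline{\mathfrak H}^{\otimes q}$ (where $\overline{\mathfrak H}$ is the conjugate Hilbert space), the complex multiple Wiener–Itô integral is $$I_{p,q}(f)=\sum_{j,l}a_{j,l}\,\sqrt{\mathbf m!\,\mathbf n!}\ \prod_k\frac{1}{\sqrt{2^{m_k+n_k}m_k!\,n_k!}}\,J_{m_k,n_k}\big(\sqrt2\,Z(e_k)\big)\quad\text{in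 }L^2(\Omega),$$ where $m_k=\#\{i:j_i=k\}$, $n_k=\#\{i:l_i=k\}$, $\mathbf m!=\prod_k m_k!$ and $\mathbf n!=\prod_k n_k!$. Corollary (exponential integrability). For every such $f$ (in particular for every $f\in\mathfrak H^{\odot p}\otimes\overline{\mathfrak H}^{\odot q}$) there is a constant $c_0>0$ such that $$E\exp\Big\{c\,|I_{p,q}(f)|^{\frac{2}{p+q}}\Big\}<\infty\qquad\text{for all real } c\le c_0 .$$ -/

import Mathlib

open MeasureTheory ProbabilityTheory
open scoped TensorProduct ENNReal

noncomputable section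

namespace WienerIto

universe u

/-! ### Complex Hermite polynomials -/

/-- The complex Hermite polynomial
`J_{m,n}(z, ρ) = ∑_{r ≤ m ∧ n} (-1)^r r! C(m,r) C(n,r) z^{m-r} z̄^{n-r} ρ^r`. -/
def complexHermite (m n : ℕ) (z : ℂ) (ρ : ℝ) : ℂ :=
  ∑ r ∈ Finset.range (min m n + 1),
    (-1 : ℂ) ^ r * (r.factorial : ℂ) * (m.choose r : ℂ) * (n.choose r : ℂ) *
      z ^ (m - r) * (starRingEnd ℂ z) ^ (n - r) * (ρ : ℂ) ^ r

/-! ### Complex Gaussian isonormal processes -/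

/-- `Z = {Z(h) : h ∈ H}` is a complex Gaussian isonormal process over `H`: a jointly Gaussian,
centred family with `E[Z(h)²] = 0` and `E[Z(g) conj (Z(h))] = ⟨g, h⟩`, where `⟨g, h⟩` is linear in
`g`; since Mathlib's inner product is linear in the second slot this is `inner ℂ h g`. -/
structure IsComplexIsonormal {Ω : Type*} [MeasurableSpace Ω] {H : Type*} [NormedAddCommGroup H]
    [InnerProductSpace ℂ H] (Z : H → Ω → ℂ) (P : Measure Ω) : Prop where
  isGaussianProcess : IsGaussianProcess Z P
  integral_eq_zero : ∀ h : H, ∫ ω, Z h ω ∂P = 0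
  integral_sq_eq_zero : ∀ h : H, ∫ ω, (Z h ω) ^ 2 ∂P = 0
  integral_mul_conj : ∀ g h : H, ∫ ω, Z g ω * starRingEnd ℂ (Z h ω) ∂P = inner ℂ h g

/-! ### The conjugate Hilbert space -/

/-- The complex conjugate of a complex vector space: the same additive group, with scalar
multiplication `c • h̄ = (c̄ h)‾`. -/
def ConjSpace (H : Type u) : Type u := H

/-- The conjugation map `h ↦ h̄`. -/
def toConj {H : Type u} (h : H) : ConjSpace H := h

/-- The inverse `h̄ ↦ h` of the conjugation map. -/
def ofConj {H : Type u} (h : ConjSpace H) : H := h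

namespace ConjSpace

variable {H : Type u} [NormedAddCommGroup H]

instance : NormedAddCommGroup (ConjSpace H) := inferInstanceAs (NormedAddCommGroup H)

instance [CompleteSpace H] : CompleteSpace (ConjSpace H) := inferInstanceAs (CompleteSpace H)

theorem norm_ofConj (h : ConjSpace H) : ‖ofConj h‖ = ‖h‖ := rfl

variable [InnerProductSpace ℂ H]

instance : Module ℂ (ConjSpace H) := Module.compHom H (starRingEnd ℂ)

theorem ofConj_smul (c : ℂ) (h : ConjSpace H) : ofConj (c • h) = starRingEnd ℂ c • ofConj h := rfl

instance : NormedSpace ℂ (ConjSpace H) where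
  norm_smul_le c h := by
    rw [← norm_ofConj, ofConj_smul, norm_smul, RCLike.norm_conj, norm_ofConj]

/-- `⟨ḡ, h̄⟩ = ⟨h, g⟩`. -/
instance : InnerProductSpace ℂ (ConjSpace H) where
  inner g h := inner ℂ (ofConj h) (ofConj g)
  norm_sq_eq_re_inner h := norm_sq_eq_re_inner (𝕜 := ℂ) (ofConj h)
  conj_inner_symm g h := inner_conj_symm (𝕜 := ℂ) (ofConj h) (ofConj g)
  add_left f g h := inner_add_right (𝕜 := ℂ) (ofConj h) (ofConj f) (ofConj g)
  smul_left g h c := by rw [ofConj_smul, inner_smul_right]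

end ConjSpace

/-! ### Hilbert space tensor powers -/

/-- A type together with a complex Hilbert space structure. -/
structure HilbertObj : Type (u + 1) where
  carrier : Type u
  [normedAddCommGroup : NormedAddCommGroup carrier]
  [innerProductSpace : InnerProductSpace ℂ carrier]
  [completeSpace : CompleteSpace carrier]

attribute [instance] HilbertObj.normedAddCommGroup HilbertObj.innerProductSpace
  HilbertObj.completeSpace

/-- The Hilbert space tensor power `H^{⊗n}`, by recursion: `H^{⊗0}` is one-dimensional, and
`H^{⊗(n+1)}` is the completion of the algebraic tensor product `H ⊗ H^{⊗n}` for the inner product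
`⟨a ⊗ b, c ⊗ d⟩ = ⟨a, c⟩ ⟨b, d⟩`. -/
def tensorPowObj (H : Type u) [NormedAddCommGroup H] [InnerProductSpace ℂ H] : ℕ → HilbertObj.{u}
  | 0 => ⟨EuclideanSpace ℂ PUnit.{u + 1}⟩
  | n + 1 => ⟨UniformSpace.Completion (H ⊗[ℂ] (tensorPowObj H n).carrier)⟩

/-- The underlying Hilbert space of `H^{⊗n}`. -/
abbrev TensorPow (H : Type u) [NormedAddCommGroup H] [InnerProductSpace ℂ H] (n : ℕ) : Type u :=
  (tensorPowObj H n).carrier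

/-- The elementary tensor `v₀ ⊗ ⋯ ⊗ v_{n-1}` in `H^{⊗n}`. -/
def pureTensor {H : Type u} [NormedAddCommGroup H] [InnerProductSpace ℂ H] :
    (n : ℕ) → (Fin n → H) → TensorPow H n
  | 0, _ => EuclideanSpace.single PUnit.unit (1 : ℂ)
  | n + 1, v =>
    ((v 0 ⊗ₜ[ℂ] pureTensor n (fun i => v i.succ) : H ⊗[ℂ] TensorPow H n) :
      UniformSpace.Completion (H ⊗[ℂ] TensorPow H n))

/-- The space of kernels: the Hilbert space tensor product `H^{⊗p} ⊗ H̄^{⊗q}`. -/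
abbrev KernelSpace (H : Type u) [NormedAddCommGroup H] [InnerProductSpace ℂ H] (p q : ℕ) : Type u :=
  UniformSpace.Completion (TensorPow H p ⊗[ℂ] TensorPow (ConjSpace H) q)

/-- The elementary kernel `v₁ ⊗ ⋯ ⊗ v_p ⊗ w̄₁ ⊗ ⋯ ⊗ w̄_q`. -/
def elemKernel {H : Type u} [NormedAddCommGroup H] [InnerProductSpace ℂ H] {p q : ℕ}
    (v : Fin p → H) (w : Fin q → H) : KernelSpace H p q :=
  ((pureTensor p v ⊗ₜ[ℂ] pureTensor q (fun i => toConj (w i)) :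
    TensorPow H p ⊗[ℂ] TensorPow (ConjSpace H) q) : KernelSpace H p q)

/-! ### Fourier-Hermite polynomials and multiple Wiener-Itô integrals -/

section Integral

variable {Ω : Type*} [MeasurableSpace Ω] {P : Measure Ω}
  {H : Type u} [NormedAddCommGroup H] [InnerProductSpace ℂ H] {ι : Type*}

/-- The Fourier-Hermite polynomial
`J_{𝐦,𝐧} = ∏_k (2^{m_k+n_k} m_k! n_k!)^{-1/2} J_{m_k,n_k}(√2 Z(e_k))`, with `J_{m,n}(z) =
J_{m,n}(z, 2)`; the factors with `m_k = n_k = 0` are equal to one. -/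
def fourierHermite (Z : H → Ω → ℂ) (e : ι → H) (m n : ι →₀ ℕ) (ω : Ω) : ℂ :=
  open Classical in
  ∏ k ∈ m.support ∪ n.support,
    ((Real.sqrt (2 ^ (m k + n k) * (m k).factorial * (n k).factorial))⁻¹ : ℂ) *
      complexHermite (m k) (n k) (Real.sqrt 2 * Z (e k) ω) 2

/-- The multi-index of a finite sequence `j` of indices: `k ↦ #{i : j i = k}`. -/
def multiIndex {p : ℕ} (j : Fin p → ι) : ι →₀ ℕ := ∑ i, Finsupp.single (j i) 1

/-- `𝐦! = ∏_k m_k!`. -/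
def multiFactorial (m : ι →₀ ℕ) : ℕ := m.prod fun _ r => r.factorial

/-- The multiple integral of the basis kernel `e_{j₁} ⊗ ⋯ ⊗ e_{j_p} ⊗ ē_{l₁} ⊗ ⋯ ⊗ ē_{l_q}`, that
is, of its symmetrization in the first `p` and in the last `q` variables. It is
`√(𝐦! 𝐧!) J_{𝐦,𝐧}`, where `𝐦` and `𝐧` are the multi-indices of `j` and `l`. -/
def basisIntegral (Z : H → Ω → ℂ) (e : ι → H) {p q : ℕ} (j : Fin p → ι) (l : Fin q → ι) (ω : Ω) :
    ℂ :=
  (Real.sqrt (multiFactorial (multiIndex j) * multiFactorial (multiIndex l)) : ℂ) *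
    fourierHermite Z e (multiIndex j) (multiIndex l) ω

/-- `F` has finite moments of all orders. -/
def HasAllMoments (F : Ω → ℂ) (P : Measure Ω) : Prop := ∀ r : ℝ≥0∞, r ≠ ∞ → MemLp F r P

theorem HasAllMoments.mul {F G : Ω → ℂ} (hF : HasAllMoments F P) (hG : HasAllMoments G P) :
    HasAllMoments (fun ω => F ω * G ω) P := by
  intro r hr
  have hr2 : 2 * r ≠ ∞ := ENNReal.mul_ne_top ENNReal.ofNat_ne_top hr
  have : ENNReal.HolderTriple (2 * r) (2 * r) r := by
    constructor
    rw [ENNReal.mul_inv (by simp) (by simp), ← add_mul, ENNReal.inv_two_add_inv_two, one_mul]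
  exact MemLp.mul' (hG _ hr2) (hF _ hr2)

theorem HasAllMoments.const [IsFiniteMeasure P] (c : ℂ) : HasAllMoments (fun _ : Ω => c) P :=
  fun _ _ => memLp_const c

theorem HasAllMoments.prod [IsFiniteMeasure P] {κ : Type*} (s : Finset κ) {F : κ → Ω → ℂ}
    (hF : ∀ k ∈ s, HasAllMoments (F k) P) : HasAllMoments (fun ω => ∏ k ∈ s, F k ω) P := by
  classical
  induction s using Finset.induction_on with
  | empty => simpa using HasAllMoments.const (1 : ℂ)
  | insert a s ha ih =>
    simp only [Finset.prod_insert ha]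
    exact (hF a (Finset.mem_insert_self a s)).mul
      (ih fun k hk => hF k (Finset.mem_insert_of_mem hk))

theorem HasAllMoments.sum {κ : Type*} (s : Finset κ) {F : κ → Ω → ℂ}
    (hF : ∀ k ∈ s, HasAllMoments (F k) P) : HasAllMoments (fun ω => ∑ k ∈ s, F k ω) P :=
  fun r hr => memLp_finsetSum s fun k hk => hF k hk r hr

theorem HasAllMoments.pow [IsFiniteMeasure P] {F : Ω → ℂ} (hF : HasAllMoments F P) (n : ℕ) :
    HasAllMoments (fun ω => F ω ^ n) P := by
  simpa using HasAllMoments.prod (Finset.range n) (F := fun _ => F) fun _ _ => hF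

theorem HasAllMoments.conj {F : Ω → ℂ} (hF : HasAllMoments F P) :
    HasAllMoments (fun ω => starRingEnd ℂ (F ω)) P :=
  fun r hr => (hF r hr).star

theorem IsComplexIsonormal.isProbabilityMeasure {Z : H → Ω → ℂ} (hZ : IsComplexIsonormal Z P) :
    IsProbabilityMeasure P :=
  hZ.isGaussianProcess.isProbabilityMeasure

theorem IsComplexIsonormal.memLp_basisIntegral {Z : H → Ω → ℂ} (hZ : IsComplexIsonormal Z P)
    (e : ι → H) {p q : ℕ} (j : Fin p → ι) (l : Fin q → ι) :
    MemLp (basisIntegral Z e j l) 2 P := by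
  have := hZ.isProbabilityMeasure
  have hall : ∀ k, HasAllMoments (fun ω => (Real.sqrt 2 : ℂ) * Z (e k) ω) P := fun k =>
    (HasAllMoments.const _).mul fun r hr =>
      (hZ.isGaussianProcess.hasGaussianLaw_eval (e k)).memLp hr
  have h : HasAllMoments (basisIntegral Z e j l) P := by
    refine (HasAllMoments.const _).mul (HasAllMoments.prod _ fun k _ => ?_)
    refine (HasAllMoments.const _).mul (HasAllMoments.sum _ fun r _ => ?_)
    exact (((HasAllMoments.const _).mul ((hall k).pow _)).mul ((hall k).conj.pow _)).mul
      (HasAllMoments.const _)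
  exact h 2 (by simp)

/-- The complex multiple Wiener-Itô integral `I_{p,q}(f) ∈ L²(Ω)` of a kernel
`f ∈ H^{⊗p} ⊗ H̄^{⊗q}` with respect to `Z`. Expanding
`f = ∑_{j,l} a_{j,l} e_{j₁} ⊗ ⋯ ⊗ e_{j_p} ⊗ ē_{l₁} ⊗ ⋯ ⊗ ē_{l_q}` in a complete orthonormal system,
`I_{p,q}(f) = ∑_{j,l} a_{j,l} I_{p,q}(e_{j₁} ⊗ ⋯ ⊗ e_{j_p} ⊗ ē_{l₁} ⊗ ⋯ ⊗ ē_{l_q})` in `L²(Ω)`.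
This is the isometry of `H^{⊙p} ⊗ H̄^{⊙q}`, with norm `√(p! q!) ‖f‖`, onto the chaos of degree
`(p, q)`, precomposed with the symmetrization `f ↦ f̃`; in particular `I_{p,q}(f) = I_{p,q}(f̃)`.
The series converges for every `f`, because `∑ |a_{j,l}|² = ‖f‖²` and basis integrals with distinct
multi-indices are orthogonal in `L²(Ω)`. -/
def multipleIntegral {Z : H → Ω → ℂ} (hZ : IsComplexIsonormal Z P) (e : HilbertBasis ι ℂ H)
    {p q : ℕ} (f : KernelSpace H p q) : Lp ℂ 2 P :=
  ∑' jl : (Fin p → ι) × (Fin q → ι),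
    (inner ℂ (elemKernel (fun i => e (jl.1 i)) (fun i => e (jl.2 i))) f : ℂ) •
      (hZ.memLp_basisIntegral e jl.1 jl.2).toLp (basisIntegral Z e jl.1 jl.2)

end Integral

end WienerIto

end

/-!
The estimate behind exponential integrability is `E|I_{p,q}(f)|^{2k} ≤ (nk)! (2^n ‖f‖²)^k` for all
`k`, where `n = p + q`. It is proved without hypercontractivity, in two steps.

Let `Z'` be an independent copy of `Z`, and put `U_k = 2^{-1/2} (Z(e_k) + i Z'(e_k))` and
`V_k = 2^{-1/2} (conj Z(e_k) + i conj Z'(e_k))`. The complex Hermite polynomial is the conditional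
expectation `J_{m,n}(z, 1) = E[(z + i Z'(e_k))^m (z̄ + i conj Z'(e_k))^n]`
(`IsStdComplexGaussian.integral_wick`), so that a finite sum of basis integrals is `2^{n/2} E[Q | Z]`
with `Q` a homogeneous holomorphic polynomial of degree `n` in the variables `U_k`, `V_k`
(`IsComplexIsonormal.basisIntegral_eq_integral`). These variables turn out to be independent
standard complex Gaussian variables (`IsStdComplexGaussian.complexify_withConj`). By Jensen's
inequality it remains to bound the moments of `Q`.

For such polynomials high moments are second moments: `E|Q|^{2k} = E|Q^k|²`, and `Q^k` is a
homogeneous holomorphic polynomial of degree `nk`. By the Wick formula the second moment of a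
homogeneous holomorphic polynomial of degree `N` is at most `N!` times the square sum of its
coefficients (`IsStdComplexGaussian.integral_norm_sq_sum_le`), and the square sum for `Q^k` is the
`k`-th power of the one for `Q`.

The bound is uniform in the number of terms, and the square sum of the coefficients is at most `‖f‖²`
by Bessel's inequality. Hence the series of the multiple integral converges in `L²` and Fatou's lemma
extends the bound to `I_{p,q}(f)` (`lintegral_norm_multipleIntegral_pow_le`). Finally
`((nk)!)^{1/n}` is at most `k!` times a geometric factor, so the exponential series of
`c |I_{p,q}(f)|^{2/n}` converges in mean for small `c` (`exists_integrable_exp_mul_rpow`).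
-/

open MeasureTheory ProbabilityTheory
open scoped TensorProduct ENNReal

noncomputable section

namespace WienerIto

/-! ### Standard complex Gaussian families -/

theorem HasAllMoments.integrable {Ω : Type*} [MeasurableSpace Ω] {P : Measure Ω} {F : Ω → ℂ}
    (hF : HasAllMoments F P) : Integrable F P :=
  memLp_one_iff_integrable.1 (hF 1 (by simp))

/-- `G` is a family of independent standard complex Gaussian variables, encoded through its second
moments: a centred Gaussian process with `E[G_i G_j] = 0` and `E[G_i conj G_j] = δ_{ij}`. -/
structure IsStdComplexGaussian {Ω κ : Type*} [MeasurableSpace Ω] (G : κ → Ω → ℂ) (P : Measure Ω) :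
    Prop where
  isGaussianProcess : IsGaussianProcess G P
  integral_eq_zero : ∀ i, ∫ ω, G i ω ∂P = 0
  integral_mul : ∀ i j, ∫ ω, G i ω * G j ω ∂P = 0
  integral_mul_conj_self : ∀ i, ∫ ω, G i ω * starRingEnd ℂ (G i ω) ∂P = 1
  integral_mul_conj_of_ne : ∀ i j, i ≠ j → ∫ ω, G i ω * starRingEnd ℂ (G j ω) ∂P = 0

namespace IsStdComplexGaussian

variable {Ω κ : Type*} [MeasurableSpace Ω] {G : κ → Ω → ℂ} {P : Measure Ω}

theorem isProbabilityMeasure (hG : IsStdComplexGaussian G P) : IsProbabilityMeasure P :=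
  hG.isGaussianProcess.isProbabilityMeasure

theorem comp_injective (hG : IsStdComplexGaussian G P) {κ' : Type*} {φ : κ' → κ}
    (hφ : Function.Injective φ) : IsStdComplexGaussian (fun i => G (φ i)) P where
  isGaussianProcess := hG.isGaussianProcess.comp_right φ
  integral_eq_zero _ := hG.integral_eq_zero _
  integral_mul _ _ := hG.integral_mul _ _
  integral_mul_conj_self _ := hG.integral_mul_conj_self _
  integral_mul_conj_of_ne _ _ hij := hG.integral_mul_conj_of_ne _ _ (hφ.ne hij)

theorem hasAllMoments (hG : IsStdComplexGaussian G P) (i : κ) : HasAllMoments (G i) P :=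
  fun _ hr => (hG.isGaussianProcess.hasGaussianLaw_eval i).memLp hr

theorem integrable_mul (hG : IsStdComplexGaussian G P) (i j : κ) :
    Integrable (fun ω => G i ω * G j ω) P :=
  (hG.hasAllMoments i 2 (by simp)).integrable_mul (hG.hasAllMoments j 2 (by simp))

theorem integrable_mul_conj (hG : IsStdComplexGaussian G P) (i j : κ) :
    Integrable (fun ω => G i ω * starRingEnd ℂ (G j ω)) P :=
  (hG.hasAllMoments i 2 (by simp)).integrable_mul ((hG.hasAllMoments j).conj 2 (by simp))

/-- The mixed second moment of two real linear functionals of the family, written with the real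
inner product of `ℂ`; the moment `E[G_i G_j]` does not contribute since it vanishes. -/
theorem integral_inner_mul_inner (hG : IsStdComplexGaussian G P) (i j : κ) (x y : ℂ) :
    ∫ ω, inner ℝ x (G i ω) * inner ℝ y (G j ω) ∂P =
      (starRingEnd ℂ x * y * ∫ ω, G i ω * starRingEnd ℂ (G j ω) ∂P).re / 2 := by
  have h : ∀ ω, inner ℝ x (G i ω) * inner ℝ y (G j ω) =
      RCLike.re ((starRingEnd ℂ x * starRingEnd ℂ y / 2) * (G i ω * G j ω) +
        (starRingEnd ℂ x * y / 2) * (G i ω * starRingEnd ℂ (G j ω))) := by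
    intro ω
    simp only [Complex.inner, RCLike.re_eq_complex_re, Complex.add_re, Complex.mul_re,
      Complex.mul_im, Complex.div_ofNat_re, Complex.div_ofNat_im, Complex.conj_re, Complex.conj_im]
    ring
  have h1 := (hG.integrable_mul i j).const_mul (starRingEnd ℂ x * starRingEnd ℂ y / 2)
  have h2 := (hG.integrable_mul_conj i j).const_mul (starRingEnd ℂ x * y / 2)
  simp_rw [h]
  refine (integral_re (𝕜 := ℂ) (h1.add h2)).trans ?_
  rw [integral_add' h1 h2, integral_const_mul, integral_const_mul,
    hG.integral_mul, mul_zero, zero_add, div_mul_eq_mul_div]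
  simp

theorem covariance_inner (hG : IsStdComplexGaussian G P) (i j : κ) (x y : ℂ) :
    cov[fun ω => inner ℝ x (G i ω), fun ω => inner ℝ y (G j ω); P] =
      (starRingEnd ℂ x * y * ∫ ω, G i ω * starRingEnd ℂ (G j ω) ∂P).re / 2 := by
  have := hG.isProbabilityMeasure
  have hm : ∀ (x : ℂ) i, MemLp (fun ω => inner ℝ x (G i ω)) 2 P := fun x i =>
    (hG.hasAllMoments i 2 (by simp)).const_inner x
  have h0 : P[fun ω => inner ℝ x (G i ω)] = 0 := by
    have := integral_inner (𝕜 := ℝ) (μ := P) (f := G i)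
      ((hG.hasAllMoments i).integrable) x
    rw [this, hG.integral_eq_zero, inner_zero_right]
  rw [covariance_eq_sub (hm x i) (hm y j), h0, zero_mul, sub_zero, ← hG.integral_inner_mul_inner]
  rfl

theorem iIndepFun [Finite κ] (hG : IsStdComplexGaussian G P) : iIndepFun G P := by
  have hI : HasGaussianLaw (fun ω i => G i ω) P := by
    have := Fintype.ofFinite κ
    exact (hG.isGaussianProcess.hasGaussianLaw Finset.univ).map
      (ContinuousLinearMap.pi fun i : κ =>
        ContinuousLinearMap.proj (R := ℝ) (φ := fun _ : (Finset.univ : Finset κ) => ℂ)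
          ⟨i, Finset.mem_univ i⟩)
  refine hI.iIndepFun_of_covariance_inner fun i j hij x y => ?_
  rw [hG.covariance_inner, hG.integral_mul_conj_of_ne i j hij]
  simp

/-- The density of a standard complex Gaussian variable is `π⁻¹ exp (-|z|²)`. -/
theorem map_eq (hG : IsStdComplexGaussian G P) (i : κ) :
    P.map (G i) = (volume : Measure ℂ).withDensity
      fun z => ENNReal.ofReal (Real.pi⁻¹ * Real.exp (-‖z‖ ^ 2)) := by
  have := hG.isProbabilityMeasure
  have hgi := hG.isGaussianProcess.hasGaussianLaw_eval i
  have hpair : HasGaussianLaw (fun ω => ((G i ω).re, (G i ω).im)) P :=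
    hgi.map (Complex.reCLM.prod Complex.imCLM)
  have hre : ∀ ω, (G i ω).re = inner ℝ (1 : ℂ) (G i ω) := fun ω => by simp [Complex.inner]
  have him : ∀ ω, (G i ω).im = inner ℝ Complex.I (G i ω) := fun ω => by simp [Complex.inner]
  -- The real and imaginary parts are independent, each with variance `1 / 2`.
  have hind : IndepFun (fun ω => (G i ω).re) (fun ω => (G i ω).im) P := by
    refine hpair.indepFun_of_covariance_eq_zero ?_
    simp_rw [hre, him]
    rw [hG.covariance_inner, hG.integral_mul_conj_self]
    simp
  have hmap : ∀ x : ℂ, ‖x‖ = 1 → P.map (fun ω => inner ℝ x (G i ω)) = gaussianReal 0 (1 / 2) := by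
    intro x hx
    have h1 : HasGaussianLaw (fun ω => inner ℝ x (G i ω)) P := hgi.map (innerSL ℝ x)
    have h0 : ∫ ω, inner ℝ x (G i ω) ∂P = 0 := by
      have := integral_inner (𝕜 := ℝ) (μ := P) (f := G i)
        ((hG.hasAllMoments i).integrable) x
      rw [this, hG.integral_eq_zero, inner_zero_right]
    rw [h1.map_eq_gaussianReal, h0, ← covariance_self h1.aemeasurable, hG.covariance_inner,
      hG.integral_mul_conj_self, mul_comm (starRingEnd ℂ x), Complex.mul_conj,
      Complex.normSq_eq_norm_sq, hx]
    congr 1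
    ext
    simp
  have hjoint : P.map (fun ω => ((G i ω).re, (G i ω).im)) =
      (gaussianReal 0 (1 / 2)).prod (gaussianReal 0 (1 / 2)) := by
    rw [(indepFun_iff_map_prod_eq_prod_map_map hpair.fst.aemeasurable hpair.snd.aemeasurable).1 hind]
    simp_rw [hre, him]
    rw [hmap 1 (by simp), hmap Complex.I (by simp)]
  have hG' : G i = fun ω => Complex.measurableEquivRealProd.symm ((G i ω).re, (G i ω).im) := by
    ext ω
    exact (Complex.measurableEquivRealProd.symm_apply_apply (G i ω)).symm
  rw [hG', ← Function.comp_def, ← AEMeasurable.map_map_of_aemeasurable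
    Complex.measurableEquivRealProd.symm.measurable.aemeasurable hpair.aemeasurable, hjoint,
    gaussianReal_of_var_ne_zero _ (by norm_num), prod_withDensity (measurable_gaussianPDF _ _)
    (measurable_gaussianPDF _ _)]
  ext s hs
  rw [MeasurableEquiv.map_apply, withDensity_apply _ hs, withDensity_apply _
    (Complex.measurableEquivRealProd.symm.measurable hs),
    ← Complex.volume_preserving_equiv_real_prod.symm.setLIntegral_comp_preimage_emb
      (MeasurableEquiv.measurableEmbedding _)]
  refine setLIntegral_congr_fun (Complex.measurableEquivRealProd.symm.measurable hs) fun z _ => ?_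
  simp only [gaussianPDF, gaussianPDFReal]
  rw [← ENNReal.ofReal_mul (by positivity)]
  congr 1
  have hz : ‖Complex.measurableEquivRealProd.symm z‖ ^ 2 = z.1 ^ 2 + z.2 ^ 2 := by
    rw [← Complex.normSq_eq_norm_sq, Complex.normSq_apply]
    simp [Complex.measurableEquivRealProd]
    ring
  rw [hz, mul_mul_mul_comm, ← Real.exp_add, ← mul_inv, Real.mul_self_sqrt (by positivity)]
  congr 2
  · simp
    field_simp
  · simp
    ring

theorem integral_comp_eq (hG : IsStdComplexGaussian G P) (i : κ) {f : ℂ → ℂ} (hf : Continuous f) :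
    ∫ ω, f (G i ω) ∂P = ∫ z : ℂ, (Real.pi⁻¹ * Real.exp (-‖z‖ ^ 2)) • f z := by
  rw [← integral_map (φ := G i) (hG.isGaussianProcess.aemeasurable i) hf.aestronglyMeasurable,
    hG.map_eq, integral_withDensity_eq_integral_toReal_smul (by fun_prop) (by simp)]
  refine integral_congr_ae (.of_forall fun z => ?_)
  simp only
  rw [ENNReal.toReal_ofReal (by positivity)]

/-- The moments of a standard complex Gaussian variable: `E[G^a conj(G)^b] = δ_{ab} a!`. -/
theorem integral_pow_mul_conj_pow (hG : IsStdComplexGaussian G P) (i : κ) (a b : ℕ) :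
    ∫ ω, G i ω ^ a * starRingEnd ℂ (G i ω) ^ b ∂P = if a = b then (a.factorial : ℂ) else 0 := by
  have hc : Continuous fun z : ℂ => z ^ a * starRingEnd ℂ z ^ b :=
    (continuous_pow a).mul (Complex.continuous_conj.pow b)
  rw [hG.integral_comp_eq i hc]
  split_ifs with hab
  · subst hab
    have h : ∀ z : ℂ, (Real.pi⁻¹ * Real.exp (-‖z‖ ^ 2)) • (z ^ a * starRingEnd ℂ z ^ a) =
        ((Real.pi⁻¹ * (‖z‖ ^ (2 * a : ℝ) * Real.exp (-‖z‖ ^ (2 : ℝ))) : ℝ) : ℂ) := by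
      intro z
      have h2 : ‖z‖ ^ (2 * a : ℝ) = (‖z‖ ^ 2) ^ a := by
        rw [Real.rpow_mul (norm_nonneg _), Real.rpow_natCast, Real.rpow_two]
      rw [← mul_pow, Complex.mul_conj, Complex.normSq_eq_norm_sq, h2, Real.rpow_two,
        Complex.real_smul]
      push_cast
      ring
    simp_rw [h]
    rw [integral_complex_ofReal, integral_const_mul,
      Complex.integral_rpow_mul_exp_neg_rpow (by norm_num)
        (by have : (0 : ℝ) ≤ a := by positivity
            linarith)]
    have : ((2 * a + 2) / 2 : ℝ) = a + 1 := by ring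
    rw [this, Real.Gamma_nat_eq_factorial]
    norm_num
  · -- The density is rotation invariant, while the integrand is multiplied by `u ^ (a - b) = -1`
    -- under the rotation by `u = exp (iπ / (a - b))`.
    set u : Circle := Circle.exp (Real.pi / ((a : ℝ) - b)) with hu
    have hab' : (a : ℝ) - b ≠ 0 := sub_ne_zero.2 (by exact_mod_cast hab)
    have huab : (u : ℂ) ^ a * starRingEnd ℂ (u : ℂ) ^ b = -1 := by
      rw [← Circle.coe_inv_eq_conj, hu, ← Circle.exp_neg, Circle.coe_exp, Circle.coe_exp,
        ← Complex.exp_nat_mul, ← Complex.exp_nat_mul, ← Complex.exp_add, ← Complex.exp_pi_mul_I]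
      congr 1
      have : (a : ℂ) - b ≠ 0 := by exact_mod_cast hab'
      push_cast
      field_simp
      ring
    have hrot := (rotation u).measurePreserving.integral_comp'
      (f := (rotation u).toMeasurableEquiv)
      (g := fun z : ℂ => (Real.pi⁻¹ * Real.exp (-‖z‖ ^ 2)) • (z ^ a * starRingEnd ℂ z ^ b))
    have hneg : ∀ z : ℂ, (Real.pi⁻¹ * Real.exp (-‖rotation u z‖ ^ 2)) •
        (rotation u z ^ a * starRingEnd ℂ (rotation u z) ^ b) =
        -((Real.pi⁻¹ * Real.exp (-‖z‖ ^ 2)) • (z ^ a * starRingEnd ℂ z ^ b)) := by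
      intro z
      rw [LinearIsometryEquiv.norm_map, rotation_apply, map_mul, mul_pow, mul_pow,
        mul_mul_mul_comm, huab, neg_one_mul, smul_neg]
    have : (∫ z : ℂ, (Real.pi⁻¹ * Real.exp (-‖z‖ ^ 2)) • (z ^ a * starRingEnd ℂ z ^ b)) =
        -∫ z : ℂ, (Real.pi⁻¹ * Real.exp (-‖z‖ ^ 2)) • (z ^ a * starRingEnd ℂ z ^ b) := by
      rw [← integral_neg]
      refine Eq.trans hrot.symm ?_
      exact integral_congr_ae (.of_forall hneg)
    exact self_eq_neg.1 this

end IsStdComplexGaussian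

/-! ### Joint moments -/

/-- The permutations carrying `s` to `t` form, if there are any, a coset of the stabilizer of `s`. -/
theorem card_perm_comp_eq {ν κ : Type*} [Fintype ν] [Fintype κ] [DecidableEq ν] [DecidableEq κ]
    (s t : ν → κ) :
    Fintype.card {σ : Equiv.Perm ν // s ∘ σ = t} =
      if ∀ k, Fintype.card {i // s i = k} = Fintype.card {i // t i = k} then
        ∏ k, (Fintype.card {i // s i = k}).factorial else 0 := by
  split_ifs with h
  · let τ : Equiv.Perm ν := Equiv.ofFiberEquiv fun k => Fintype.equivOfCardEq (h k).symm
    have hτ : s ∘ τ = t := funext fun i => Equiv.ofFiberEquiv_map _ i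
    rw [← DomMulAct.stabilizer_card s]
    refine Fintype.card_congr ((Equiv.mulRight τ⁻¹).subtypeEquiv fun σ => ?_)
    rw [← hτ]
    constructor
    · intro hσ
      ext i
      simpa using congrFun hσ (τ⁻¹ i)
    · intro hσ
      ext i
      simpa using congrFun hσ (τ i)
  · rw [Fintype.card_eq_zero_iff]
    refine ⟨fun ⟨σ, hσ⟩ => h fun k => ?_⟩
    subst hσ
    exact (Fintype.card_congr (σ.subtypeEquiv fun i => Iff.rfl)).symm

namespace IsStdComplexGaussian

variable {Ω κ : Type*} [MeasurableSpace Ω] {G : κ → Ω → ℂ} {P : Measure Ω}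

theorem integral_prod_comp [Fintype κ] (hG : IsStdComplexGaussian G P) {f : κ → ℂ → ℂ}
    (hf : ∀ i, Continuous (f i)) :
    ∫ ω, ∏ i, f i (G i ω) ∂P = ∏ i, ∫ ω, f i (G i ω) ∂P :=
  hG.iIndepFun.integral_fun_prod_comp (fun i => hG.isGaussianProcess.aemeasurable i)
    fun i => (hf i).aestronglyMeasurable

theorem hasAllMoments_prod {ν : Type*} [Fintype ν] (hG : IsStdComplexGaussian G P) (s : ν → κ) :
    HasAllMoments (fun ω => ∏ i, G (s i) ω) P := by
  have := hG.isProbabilityMeasure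
  exact HasAllMoments.prod _ fun i _ => hG.hasAllMoments (s i)

/-- The Wick formula: the mixed moment of two monomials counts the matchings of their factors. -/
theorem integral_prod_mul_conj_prod {ν : Type*} [Fintype ν] [DecidableEq ν] [DecidableEq κ]
    (hG : IsStdComplexGaussian G P) (s t : ν → κ) :
    ∫ ω, (∏ i, G (s i) ω) * starRingEnd ℂ (∏ i, G (t i) ω) ∂P =
      Fintype.card {σ : Equiv.Perm ν // s ∘ σ = t} := by
  -- Only finitely many members of the family occur.
  wlog hκ : Finite κ generalizing κ
  · let K : Set κ := Set.range s ∪ Set.range t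
    let s' : ν → K := fun i => ⟨s i, Or.inl ⟨i, rfl⟩⟩
    let t' : ν → K := fun i => ⟨t i, Or.inr ⟨i, rfl⟩⟩
    have hK : Finite K := ((Set.finite_range s).union (Set.finite_range t)).to_subtype
    refine (this (hG.comp_injective (φ := ((↑) : K → κ)) Subtype.val_injective) s' t' hK).trans ?_
    congr 1
    refine Fintype.card_congr (Equiv.subtypeEquivRight fun σ => ?_)
    simp only [funext_iff, Function.comp_apply, s', t', Subtype.ext_iff]
  have := Fintype.ofFinite κ
  have h : ∀ ω, (∏ i, G (s i) ω) * starRingEnd ℂ (∏ i, G (t i) ω) =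
      ∏ k, (G k ω ^ Fintype.card {i // s i = k} *
        starRingEnd ℂ (G k ω) ^ Fintype.card {i // t i = k}) := by
    intro ω
    rw [map_prod, Finset.prod_mul_distrib, ← Fintype.prod_fiberwise' s fun k => G k ω,
      ← Fintype.prod_fiberwise' t fun k => starRingEnd ℂ (G k ω)]
    simp
  simp_rw [h]
  rw [hG.integral_prod_comp
    (f := fun k z => z ^ Fintype.card {i // s i = k} *
      starRingEnd ℂ z ^ Fintype.card {i // t i = k})
    fun k => (continuous_pow _).mul (Complex.continuous_conj.pow _)]
  simp_rw [hG.integral_pow_mul_conj_pow]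
  rw [card_perm_comp_eq]
  split_ifs with hst
  · simp [hst]
  · push Not at hst
    obtain ⟨k, hk⟩ := hst
    rw [Finset.prod_eq_zero (Finset.mem_univ k) (if_neg hk), Nat.cast_zero]

/-- A homogeneous holomorphic polynomial of degree `N` has second moment at most `N!` times the
square sum of its coefficients, even if its monomials are written with ordered variables: a
monomial is matched with at most `N!` others. -/
theorem integral_norm_sq_sum_le {ν I : Type*} [Fintype ν] [Fintype I]
    (hG : IsStdComplexGaussian G P) {s : I → ν → κ} (hs : Function.Injective s) (a : I → ℂ) :
    ∫ ω, ‖∑ x, a x * ∏ i, G (s x i) ω‖ ^ 2 ∂P ≤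
      (Fintype.card ν).factorial * ∑ x, ‖a x‖ ^ 2 := by
  classical
  have hint : ∀ x y : I, Integrable (fun ω => a x * starRingEnd ℂ (a y) *
      ((∏ i, G (s x i) ω) * starRingEnd ℂ (∏ i, G (s y i) ω))) P := fun x y =>
    ((hG.hasAllMoments_prod (s x)).mul (hG.hasAllMoments_prod (s y)).conj).integrable.const_mul _
  have hexp : ∀ ω, (((‖∑ x, a x * ∏ i, G (s x i) ω‖ ^ 2 : ℝ)) : ℂ) =
      ∑ x, ∑ y, a x * starRingEnd ℂ (a y) *
        ((∏ i, G (s x i) ω) * starRingEnd ℂ (∏ i, G (s y i) ω)) := by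
    intro ω
    rw [← Complex.normSq_eq_norm_sq, ← Complex.mul_conj, map_sum, Finset.sum_mul_sum]
    refine Finset.sum_congr rfl fun x _ => Finset.sum_congr rfl fun y _ => ?_
    rw [map_mul]
    ring
  have hval : ((∫ ω, ‖∑ x, a x * ∏ i, G (s x i) ω‖ ^ 2 ∂P : ℝ) : ℂ) =
      ∑ x, ∑ y, a x * starRingEnd ℂ (a y) *
        ∑ σ : Equiv.Perm ν, if s x ∘ σ = s y then (1 : ℂ) else 0 := by
    rw [← integral_complex_ofReal]
    simp_rw [hexp]
    rw [integral_finsetSum _ fun x _ => integrable_finsetSum _ fun y _ => hint x y]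
    refine Finset.sum_congr rfl fun x _ => ?_
    rw [integral_finsetSum _ fun y _ => hint x y]
    refine Finset.sum_congr rfl fun y _ => ?_
    rw [integral_const_mul, hG.integral_prod_mul_conj_prod, Fintype.card_subtype,
      Finset.sum_boole]
  have hnonneg : 0 ≤ ∫ ω, ‖∑ x, a x * ∏ i, G (s x i) ω‖ ^ 2 ∂P :=
    integral_nonneg fun ω => by positivity
  have hterm : ∀ x y (σ : Equiv.Perm ν),
      ‖a x * starRingEnd ℂ (a y) * if s x ∘ σ = s y then (1 : ℂ) else 0‖ ≤
        (if s x ∘ σ = s y then ‖a x‖ ^ 2 / 2 else 0) +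
          if s x ∘ σ = s y then ‖a y‖ ^ 2 / 2 else 0 := by
    intro x y σ
    split_ifs
    · rw [mul_one, norm_mul, RCLike.norm_conj]
      nlinarith [sq_nonneg (‖a x‖ - ‖a y‖)]
    · simp
  -- For a given `σ`, each index is matched with at most one other.
  have hone : ∀ (b : ℝ), 0 ≤ b → ∀ (p : I → Prop) [DecidablePred p],
      (∀ y y', p y → p y' → y = y') → ∑ y, (if p y then b else 0) ≤ b := by
    intro b hb p _ hp
    by_cases h : ∃ y, p y
    · obtain ⟨y, hy⟩ := h
      rw [Finset.sum_eq_single y (fun z _ hz => if_neg fun h => hz (hp z y h hy)) (by simp),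
        if_pos hy]
    · push Not at h
      simpa [h] using hb
  calc ∫ ω, ‖∑ x, a x * ∏ i, G (s x i) ω‖ ^ 2 ∂P
      = ‖((∫ ω, ‖∑ x, a x * ∏ i, G (s x i) ω‖ ^ 2 ∂P : ℝ) : ℂ)‖ := by
        rw [Complex.norm_real, Real.norm_of_nonneg hnonneg]
    _ ≤ ∑ x, ∑ y, ∑ σ : Equiv.Perm ν, ((if s x ∘ σ = s y then ‖a x‖ ^ 2 / 2 else 0) +
          if s x ∘ σ = s y then ‖a y‖ ^ 2 / 2 else 0) := by
        rw [hval]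
        refine (norm_sum_le _ _).trans (Finset.sum_le_sum fun x _ => (norm_sum_le _ _).trans
          (Finset.sum_le_sum fun y _ => ?_))
        rw [Finset.mul_sum]
        exact (norm_sum_le _ _).trans (Finset.sum_le_sum fun σ _ => hterm x y σ)
    _ = ∑ σ : Equiv.Perm ν, ((∑ x, ∑ y, if s x ∘ σ = s y then ‖a x‖ ^ 2 / 2 else 0) +
          ∑ y, ∑ x, if s x ∘ σ = s y then ‖a y‖ ^ 2 / 2 else 0) := by
        simp_rw [Finset.sum_add_distrib]
        congr 1
        · rw [Finset.sum_comm_cycle]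
        · rw [Finset.sum_comm_cycle]
          exact Finset.sum_congr rfl fun σ _ => Finset.sum_comm
    _ ≤ ∑ σ : Equiv.Perm ν, ((∑ x, ‖a x‖ ^ 2 / 2) + ∑ y, ‖a y‖ ^ 2 / 2) := by
        refine Finset.sum_le_sum fun σ _ => add_le_add (Finset.sum_le_sum fun x _ =>
          hone _ (by positivity) _ fun y y' h h' => hs (h.symm.trans h'))
          (Finset.sum_le_sum fun y _ => hone _ (by positivity) _ fun x x' h h' =>
            hs (funext fun i => ?_))
        simpa using congrFun (h.trans h'.symm) (σ⁻¹ i)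
    _ = (Fintype.card ν).factorial * ∑ x, ‖a x‖ ^ 2 := by
        simp_rw [← Finset.sum_add_distrib, add_halves]
        rw [Finset.sum_const, Finset.card_univ, Fintype.card_perm, nsmul_eq_mul]

/-- The moments of a homogeneous holomorphic polynomial `Q` of degree `|ν|`. Since `Q ^ k` is again
a homogeneous holomorphic polynomial, its `2k`-th moment is a second moment. -/
theorem integral_norm_pow_sum_le {ν I : Type*} [Fintype ν] [Fintype I]
    (hG : IsStdComplexGaussian G P) {s : I → ν → κ} (hs : Function.Injective s) (a : I → ℂ)
    (k : ℕ) :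
    ∫ ω, ‖∑ x, a x * ∏ i, G (s x i) ω‖ ^ (2 * k) ∂P ≤
      (Fintype.card ν * k).factorial * (∑ x, ‖a x‖ ^ 2) ^ k := by
  classical
  let s' : (Fin k → I) → Fin k × ν → κ := fun x i => s (x i.1) i.2
  have hs' : Function.Injective s' := fun x y hxy =>
    funext fun j => hs (funext fun i => congrFun hxy (j, i))
  have h := hG.integral_norm_sq_sum_le hs' fun x => ∏ j, a (x j)
  have hpow : ∀ ω, ∑ x : Fin k → I, (∏ j, a (x j)) * ∏ i, G (s' x i) ω =
      (∑ x, a x * ∏ i, G (s x i) ω) ^ k := by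
    intro ω
    rw [Fintype.sum_pow]
    refine Finset.sum_congr rfl fun x _ => ?_
    rw [Fintype.prod_prod_type, Finset.prod_mul_distrib]
  have hcoef : ∑ x : Fin k → I, ‖∏ j, a (x j)‖ ^ 2 = (∑ x, ‖a x‖ ^ 2) ^ k := by
    rw [Fintype.sum_pow]
    refine Finset.sum_congr rfl fun x _ => ?_
    rw [norm_prod, Finset.prod_pow]
  simp_rw [hpow, hcoef, norm_pow, ← pow_mul] at h
  rw [Fintype.card_prod, Fintype.card_fin] at h
  simpa only [mul_comm] using h

end IsStdComplexGaussian

/-! ### The isonormal process along an orthonormal family -/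

section Isonormal

variable {Ω : Type*} [MeasurableSpace Ω] {P : Measure Ω}
  {H : Type*} [NormedAddCommGroup H] [InnerProductSpace ℂ H] {Z : H → Ω → ℂ}

theorem integral_sub_sub {f g h : Ω → ℂ} (hf : Integrable f P) (hg : Integrable g P)
    (hh : Integrable h P) :
    ∫ ω, f ω - g ω - h ω ∂P = ∫ ω, f ω ∂P - ∫ ω, g ω ∂P - ∫ ω, h ω ∂P := by
  have hfg : Integrable (fun ω => f ω - g ω) P := hf.sub hg
  rw [integral_sub hfg hh, integral_sub hf hg]

theorem IsComplexIsonormal.memLp_two (hZ : IsComplexIsonormal Z P) (h : H) : MemLp (Z h) 2 P :=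
  (hZ.isGaussianProcess.hasGaussianLaw_eval h).memLp_two

/-- The process is additive, since `E|Z(g + h) - Z(g) - Z(h)|² = 0` by the covariance formula. -/
theorem IsComplexIsonormal.add_ae_eq (hZ : IsComplexIsonormal Z P) (g h : H) :
    (fun ω => Z (g + h) ω) =ᵐ[P] fun ω => Z g ω + Z h ω := by
  have hm : ∀ x y, Integrable (fun ω => Z x ω * starRingEnd ℂ (Z y ω)) P := fun x y =>
    (hZ.memLp_two x).integrable_mul (hZ.memLp_two y).star
  have hsub : MemLp (fun ω => Z (g + h) ω - Z g ω - Z h ω) 2 P :=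
    ((hZ.memLp_two _).sub (hZ.memLp_two _)).sub (hZ.memLp_two _)
  have h0 : ∫ ω, ((‖Z (g + h) ω - Z g ω - Z h ω‖ ^ 2 : ℝ) : ℂ) ∂P = 0 := by
    have hexp : ∀ ω, ((‖Z (g + h) ω - Z g ω - Z h ω‖ ^ 2 : ℝ) : ℂ) =
        (((Z (g + h) ω * starRingEnd ℂ (Z (g + h) ω) - Z (g + h) ω * starRingEnd ℂ (Z g ω)) -
          Z (g + h) ω * starRingEnd ℂ (Z h ω)) -
        ((Z g ω * starRingEnd ℂ (Z (g + h) ω) - Z g ω * starRingEnd ℂ (Z g ω)) -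
          Z g ω * starRingEnd ℂ (Z h ω))) -
        ((Z h ω * starRingEnd ℂ (Z (g + h) ω) - Z h ω * starRingEnd ℂ (Z g ω)) -
          Z h ω * starRingEnd ℂ (Z h ω)) := by
      intro ω
      rw [← Complex.normSq_eq_norm_sq, ← Complex.mul_conj]
      simp only [map_sub]
      ring
    simp_rw [hexp]
    have h3 : ∀ x, Integrable (fun ω => (Z x ω * starRingEnd ℂ (Z (g + h) ω) -
        Z x ω * starRingEnd ℂ (Z g ω)) - Z x ω * starRingEnd ℂ (Z h ω)) P := fun x =>
      ((hm _ _).sub (hm _ _)).sub (hm _ _)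
    have h4 : ∀ x, ∫ ω, (Z x ω * starRingEnd ℂ (Z (g + h) ω) -
        Z x ω * starRingEnd ℂ (Z g ω)) - Z x ω * starRingEnd ℂ (Z h ω) ∂P = 0 := by
      intro x
      rw [integral_sub_sub (hm _ _) (hm _ _) (hm _ _)]
      simp only [hZ.integral_mul_conj, inner_add_left]
      ring
    rw [integral_sub_sub (h3 _) (h3 _) (h3 _), h4, h4, h4]
    simp
  rw [integral_complex_ofReal, Complex.ofReal_eq_zero, integral_eq_zero_iff_of_nonneg
    (fun ω => by positivity) (hsub.integrable_norm_pow two_ne_zero)] at h0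
  filter_upwards [h0] with ω hω
  have : Z (g + h) ω - Z g ω - Z h ω = 0 := by simpa using hω
  linear_combination this

/-- The polarized form of `E[Z(h)²] = 0`. -/
theorem IsComplexIsonormal.integral_mul (hZ : IsComplexIsonormal Z P) (g h : H) :
    ∫ ω, Z g ω * Z h ω ∂P = 0 := by
  have hm : ∀ x, Integrable (fun ω => Z x ω ^ 2) P := fun x => by
    simpa only [sq] using! (hZ.memLp_two x).integrable_mul (hZ.memLp_two x)
  have hae : (fun ω => Z g ω * Z h ω) =ᵐ[P]
      fun ω => ((Z (g + h) ω ^ 2 - Z g ω ^ 2) - Z h ω ^ 2) / 2 := by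
    filter_upwards [hZ.add_ae_eq g h] with ω hω
    rw [hω]
    ring
  rw [integral_congr_ae hae, integral_div, integral_sub_sub (hm _) (hm _) (hm _)]
  simp [hZ.integral_sq_eq_zero]

theorem IsComplexIsonormal.isStdComplexGaussian (hZ : IsComplexIsonormal Z P) {ι : Type*}
    {e : ι → H} (he : Orthonormal ℂ e) : IsStdComplexGaussian (fun k => Z (e k)) P where
  isGaussianProcess := hZ.isGaussianProcess.comp_right e
  integral_eq_zero _ := hZ.integral_eq_zero _
  integral_mul _ _ := hZ.integral_mul _ _
  integral_mul_conj_self i := by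
    rw [hZ.integral_mul_conj, inner_self_eq_norm_sq_to_K, he.1 i]
    simp
  integral_mul_conj_of_ne i j hij := by rw [hZ.integral_mul_conj, he.2 hij.symm]

end Isonormal

/-! ### Complexification of a Gaussian family by an independent copy -/

/-- The process `2^{-1/2} (X + i X')`, where `X'` is an independent copy of `X`, realized on the
product of the probability space with itself. -/
def complexify {Ω κ : Type*} (X : κ → Ω → ℂ) (a : κ) (ω : Ω × Ω) : ℂ :=
  (Real.sqrt 2 : ℂ)⁻¹ * (X a ω.1 + Complex.I * X a ω.2)

theorem ofReal_sqrt_two_inv_mul_self : (Real.sqrt 2 : ℂ)⁻¹ * (Real.sqrt 2 : ℂ)⁻¹ = 1 / 2 := by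
  rw [← mul_inv, ← Complex.ofReal_mul, Real.mul_self_sqrt (by norm_num)]
  norm_num

section Complexify

variable {Ω κ : Type*} [MeasurableSpace Ω] {P : Measure Ω} {X : κ → Ω → ℂ}

theorem isGaussianProcess_complexify (hX : IsGaussianProcess X P) :
    IsGaussianProcess (complexify X) (P.prod P) where
  hasGaussianLaw I := by
    have := hX.isProbabilityMeasure
    have hI := hX.hasGaussianLaw I
    have h1 : HasGaussianLaw (fun ω : Ω × Ω => I.restrict (X · ω.1)) (P.prod P) := by
      refine ⟨?_⟩
      have h : (P.prod P).map (fun ω : Ω × Ω => I.restrict (X · ω.1)) =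
          P.map fun ω => I.restrict (X · ω) := by
        conv_rhs => rw [← measurePreserving_fst (μ := P) (ν := P) |>.map_eq]
        rw [AEMeasurable.map_map_of_aemeasurable _ measurable_fst.aemeasurable]
        · rfl
        · rw [measurePreserving_fst.map_eq]
          exact hI.aemeasurable
      rw [h]
      exact hI.isGaussian_map
    have h2 : HasGaussianLaw (fun ω : Ω × Ω => I.restrict (X · ω.2)) (P.prod P) := by
      refine ⟨?_⟩
      have h : (P.prod P).map (fun ω : Ω × Ω => I.restrict (X · ω.2)) =
          P.map fun ω => I.restrict (X · ω) := by
        conv_rhs => rw [← measurePreserving_snd (μ := P) (ν := P) |>.map_eq]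
        rw [AEMeasurable.map_map_of_aemeasurable _ measurable_snd.aemeasurable]
        · rfl
        · rw [measurePreserving_snd.map_eq]
          exact hI.aemeasurable
      rw [h]
      exact hI.isGaussian_map
    have hpair := (indepFun_prod₀ (μ := P) (ν := P) hI.aemeasurable hI.aemeasurable).hasGaussianLaw
      h1 h2
    let L : (I → ℂ) × (I → ℂ) →L[ℝ] (I → ℂ) :=
      ((Real.sqrt 2 : ℂ)⁻¹ • (ContinuousLinearMap.fst ℂ (I → ℂ) (I → ℂ) +
        Complex.I • ContinuousLinearMap.snd ℂ (I → ℂ) (I → ℂ))).restrictScalars ℝ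
    exact hpair.map L

/-- If `X` is a centred Gaussian process with `E[X_a conj X_b] = δ_{ab}`, then `2^{-1/2} (X + i X')`
is a standard complex Gaussian family, no matter what the `E[X_a X_b]` are: these cancel. -/
theorem isStdComplexGaussian_complexify (hX : IsGaussianProcess X P)
    (h0 : ∀ a, ∫ ω, X a ω ∂P = 0)
    (hself : ∀ a, ∫ ω, X a ω * starRingEnd ℂ (X a ω) ∂P = 1)
    (hne : ∀ a b, a ≠ b → ∫ ω, X a ω * starRingEnd ℂ (X b ω) ∂P = 0) :
    IsStdComplexGaussian (complexify X) (P.prod P) := by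
  have := hX.isProbabilityMeasure
  have hmem : ∀ a, MemLp (X a) 2 P := fun a => (hX.hasGaussianLaw_eval a).memLp_two
  have hint : ∀ a, Integrable (X a) P := fun a => (hX.hasGaussianLaw_eval a).integrable
  have key : ∀ (x y x' y' : Ω → ℂ), MemLp x 2 P → MemLp y 2 P → MemLp x' 2 P → MemLp y' 2 P →
      ∫ ω, x ω ∂P = 0 → ∫ ω, y ω ∂P = 0 →
      ∫ ω, (x ω.1 + Complex.I * x' ω.2) * (y ω.1 + Complex.I * y' ω.2) ∂(P.prod P) =
        ∫ ω, x ω * y ω ∂P - ∫ ω, x' ω * y' ω ∂P := by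
    intro x y x' y' hx hy hx' hy' hx0 hy0
    have hexp : ∀ ω : Ω × Ω, (x ω.1 + Complex.I * x' ω.2) * (y ω.1 + Complex.I * y' ω.2) =
        ((x ω.1 * y ω.1 - x' ω.2 * y' ω.2) + Complex.I * (x ω.1 * y' ω.2)) +
          Complex.I * (y ω.1 * x' ω.2) := by
      intro ω
      linear_combination (x' ω.2 * y' ω.2) * Complex.I_mul_I
    have i1 : Integrable (fun ω : Ω × Ω => x ω.1 * y ω.1) (P.prod P) :=
      (hx.integrable_mul hy).comp_fst P
    have i2 : Integrable (fun ω : Ω × Ω => x' ω.2 * y' ω.2) (P.prod P) :=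
      (hx'.integrable_mul hy').comp_snd P
    have i3 : Integrable (fun ω : Ω × Ω => Complex.I * (x ω.1 * y' ω.2)) (P.prod P) :=
      ((hx.integrable (by norm_num)).mul_prod (hy'.integrable (by norm_num))).const_mul _
    have i4 : Integrable (fun ω : Ω × Ω => Complex.I * (y ω.1 * x' ω.2)) (P.prod P) :=
      ((hy.integrable (by norm_num)).mul_prod (hx'.integrable (by norm_num))).const_mul _
    have i12 : Integrable (fun ω : Ω × Ω => x ω.1 * y ω.1 - x' ω.2 * y' ω.2) (P.prod P) :=
      i1.sub i2
    have i123 : Integrable (fun ω : Ω × Ω => (x ω.1 * y ω.1 - x' ω.2 * y' ω.2) +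
        Complex.I * (x ω.1 * y' ω.2)) (P.prod P) := i12.add i3
    simp_rw [hexp]
    rw [integral_add i123 i4, integral_add i12 i3, integral_sub i1 i2,
      integral_const_mul, integral_const_mul, integral_prod_mul, integral_prod_mul, hx0, hy0,
      integral_fun_fst (fun ω => x ω * y ω), integral_fun_snd (fun ω => x' ω * y' ω)]
    simp
  have hconj : ∀ a, ∫ ω, starRingEnd ℂ (X a ω) ∂P = 0 := fun a => by
    rw [integral_conj, h0, map_zero]
  have hmc : ∀ a b, ∫ ω, complexify X a ω * starRingEnd ℂ (complexify X b ω) ∂(P.prod P) =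
      ∫ ω, X a ω * starRingEnd ℂ (X b ω) ∂P := by
    intro a b
    have hexp : ∀ ω : Ω × Ω, complexify X a ω * starRingEnd ℂ (complexify X b ω) =
        (1 / 2) * ((X a ω.1 + Complex.I * X a ω.2) *
          (starRingEnd ℂ (X b ω.1) + Complex.I * -starRingEnd ℂ (X b ω.2))) := by
      intro ω
      simp only [complexify, map_mul, map_add, map_inv₀, Complex.conj_ofReal, Complex.conj_I]
      rw [← ofReal_sqrt_two_inv_mul_self]
      ring
    simp_rw [hexp]
    rw [integral_const_mul, key (X a) (fun ω => starRingEnd ℂ (X b ω)) (X a)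
      (fun ω => -starRingEnd ℂ (X b ω)) (hmem a) (hmem b).star (hmem a) (hmem b).star.neg (h0 a)
      (hconj b)]
    simp only [mul_neg, integral_neg]
    ring
  refine ⟨isGaussianProcess_complexify hX, fun a => ?_, fun a b => ?_, fun a => ?_,
    fun a b hab => ?_⟩
  · simp only [complexify]
    rw [integral_const_mul, integral_add ((hint a).comp_fst P) (((hint a).comp_snd P).const_mul _),
      integral_const_mul, integral_fun_fst (X a), integral_fun_snd (X a), h0]
    simp
  · have hexp : ∀ ω : Ω × Ω, complexify X a ω * complexify X b ω =
        (1 / 2) * ((X a ω.1 + Complex.I * X a ω.2) * (X b ω.1 + Complex.I * X b ω.2)) := by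
      intro ω
      simp only [complexify]
      rw [← ofReal_sqrt_two_inv_mul_self]
      ring
    simp_rw [hexp]
    rw [integral_const_mul, key (X a) (X b) (X a) (X b) (hmem a) (hmem b) (hmem a) (hmem b) (h0 a)
      (h0 b), sub_self, mul_zero]
  · rw [hmc, hself]
  · rw [hmc, hne a b hab]

/-- The family `(G, conj G)`, indexed by two copies of the index set of `G`. -/
def withConj (G : κ → Ω → ℂ) : κ ⊕ κ → Ω → ℂ :=
  Sum.elim G fun k ω => starRingEnd ℂ (G k ω)

/-- Although `G` and `conj G` determine each other, their complexifications are independent: the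
family `(G, conj G)` satisfies `E[X_a conj X_b] = δ_{ab}` because `E[G_i G_j] = 0`. -/
theorem IsStdComplexGaussian.complexify_withConj {G : κ → Ω → ℂ} (hG : IsStdComplexGaussian G P) :
    IsStdComplexGaussian (complexify (withConj G)) (P.prod P) := by
  have hconj : ∀ i j, ∫ ω, starRingEnd ℂ (G i ω) * starRingEnd ℂ (starRingEnd ℂ (G j ω)) ∂P =
      ∫ ω, G j ω * starRingEnd ℂ (G i ω) ∂P := fun i j => by
    simp only [Complex.conj_conj, mul_comm]
  refine isStdComplexGaussian_complexify ?_ ?_ ?_ ?_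
  · refine hG.isGaussianProcess.of_isGaussianProcess fun a => ?_
    cases a with
    | inl k => exact ⟨{k}, ContinuousLinearMap.proj ⟨k, by simp⟩, fun ω => rfl⟩
    | inr k =>
      exact ⟨{k}, (Complex.conjCLE : ℂ →L[ℝ] ℂ).comp
        (ContinuousLinearMap.proj (R := ℝ) (φ := fun _ : ({k} : Finset κ) => ℂ) ⟨k, by simp⟩),
        fun ω => rfl⟩
  · rintro (k | k)
    · exact hG.integral_eq_zero k
    · refine integral_conj.trans ?_
      rw [hG.integral_eq_zero, map_zero]
  · rintro (k | k)
    · exact hG.integral_mul_conj_self k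
    · exact (hconj k k).trans (hG.integral_mul_conj_self k)
  · rintro (i | i) (j | j) hij
    · exact hG.integral_mul_conj_of_ne i j fun h => hij (by rw [h])
    · simpa [withConj] using hG.integral_mul i j
    · simp only [withConj, Sum.elim_inl, Sum.elim_inr, ← map_mul]
      rw [integral_conj, hG.integral_mul, map_zero]
    · exact (hconj i j).trans (hG.integral_mul_conj_of_ne j i fun h => hij (by rw [h]))

end Complexify

/-! ### Wick ordering as a conditional expectation -/

theorem prod_comp_eq_prod_pow_multiIndex {ι M : Type*} [CommMonoid M] {p : ℕ} (j : Fin p → ι)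
    (f : ι → M) {K : Finset ι} (hK : (multiIndex j).support ⊆ K) :
    ∏ i, f (j i) = ∏ k ∈ K, f k ^ multiIndex j k := by
  rw [← Finsupp.prod_of_support_subset _ hK (fun k r => f k ^ r) fun k _ => pow_zero _, multiIndex,
    ← Finsupp.prod_finsetSum_index (fun k => pow_zero _) fun k a b => pow_add _ a b]
  simp

theorem complexHermite_sqrt_two_mul (m n : ℕ) (z : ℂ) :
    complexHermite m n (Real.sqrt 2 * z) 2 =
      (Real.sqrt 2 : ℂ) ^ (m + n) * complexHermite m n z 1 := by
  simp only [complexHermite, Finset.mul_sum]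
  refine Finset.sum_congr rfl fun r hr => ?_
  have hr' : r ≤ min m n := Nat.lt_succ_iff.1 (Finset.mem_range.1 hr)
  have hm : m = (m - r) + r := (Nat.sub_add_cancel (hr'.trans (min_le_left _ _))).symm
  have hn : n = (n - r) + r := (Nat.sub_add_cancel (hr'.trans (min_le_right _ _))).symm
  have h2 : (2 : ℂ) = (Real.sqrt 2 : ℂ) * (Real.sqrt 2 : ℂ) := by
    rw [← Complex.ofReal_mul, Real.mul_self_sqrt (by norm_num)]
    norm_num
  have hpow : (Real.sqrt 2 : ℂ) ^ (m + n) =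
      (Real.sqrt 2 : ℂ) ^ (m - r) * (Real.sqrt 2 : ℂ) ^ (n - r) * (2 : ℂ) ^ r := by
    rw [h2, mul_pow, ← pow_add, ← pow_add, ← pow_add]
    congr 1
    omega
  rw [hpow, map_mul, Complex.conj_ofReal, mul_pow, mul_pow]
  push_cast
  ring

/-- The complex Hermite polynomial of variance `1` as a Gaussian mean: the `r`-th term of its
definition comes from `i^{2r} E|G_k|^{2r} = (-1)^r r!`, and all mixed powers have mean zero. -/
theorem IsStdComplexGaussian.integral_wick {Ω κ : Type*} [MeasurableSpace Ω] {G : κ → Ω → ℂ}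
    {P : Measure Ω} (hG : IsStdComplexGaussian G P) (k : κ) (m n : ℕ) (z : ℂ) :
    ∫ ω, (z + Complex.I * G k ω) ^ m *
      (starRingEnd ℂ z + Complex.I * starRingEnd ℂ (G k ω)) ^ n ∂P = complexHermite m n z 1 := by
  have := hG.isProbabilityMeasure
  have hexp : ∀ ω, (z + Complex.I * G k ω) ^ m *
      (starRingEnd ℂ z + Complex.I * starRingEnd ℂ (G k ω)) ^ n =
      ∑ r ∈ Finset.range (m + 1), ∑ s ∈ Finset.range (n + 1),
        (Complex.I ^ r * Complex.I ^ s * z ^ (m - r) * starRingEnd ℂ z ^ (n - s) *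
          (m.choose r) * (n.choose s)) * (G k ω ^ r * starRingEnd ℂ (G k ω) ^ s) := by
    intro ω
    rw [add_comm z, add_comm (starRingEnd ℂ z), add_pow, add_pow, Finset.sum_mul_sum]
    refine Finset.sum_congr rfl fun r _ => Finset.sum_congr rfl fun s _ => ?_
    rw [mul_pow, mul_pow]
    ring
  have hint : ∀ r s, Integrable (fun ω => (Complex.I ^ r * Complex.I ^ s * z ^ (m - r) *
      starRingEnd ℂ z ^ (n - s) * (m.choose r) * (n.choose s)) *
        (G k ω ^ r * starRingEnd ℂ (G k ω) ^ s)) P := fun r s =>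
    (((hG.hasAllMoments k).pow r).mul ((hG.hasAllMoments k).conj.pow s)).integrable.const_mul _
  simp_rw [hexp]
  rw [integral_finsetSum _ fun r _ => integrable_finsetSum _ fun s _ => hint r s]
  have hinner : ∀ r, ∫ ω, ∑ s ∈ Finset.range (n + 1),
      (Complex.I ^ r * Complex.I ^ s * z ^ (m - r) * starRingEnd ℂ z ^ (n - s) *
          (m.choose r) * (n.choose s)) * (G k ω ^ r * starRingEnd ℂ (G k ω) ^ s) ∂P =
      if r < n + 1 then (-1 : ℂ) ^ r * (r.factorial : ℂ) * (m.choose r : ℂ) * (n.choose r : ℂ) *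
        z ^ (m - r) * (starRingEnd ℂ z) ^ (n - r) * ((1 : ℝ) : ℂ) ^ r else 0 := by
    intro r
    rw [integral_finsetSum _ fun s _ => hint r s]
    simp_rw [integral_const_mul, hG.integral_pow_mul_conj_pow]
    simp only [mul_ite, mul_zero, Finset.sum_ite_eq, Finset.mem_range]
    refine if_congr Iff.rfl ?_ rfl
    rw [← mul_pow, Complex.I_mul_I]
    simp only [Complex.ofReal_one, one_pow]
    ring
  simp_rw [hinner]
  rw [complexHermite, ← Finset.sum_filter]
  refine Finset.sum_congr ?_ fun _ _ => rfl
  ext r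
  simp only [Finset.mem_filter, Finset.mem_range]
  omega

open Classical in
/-- All normalizing constants of a basis integral cancel if its Hermite polynomials are rescaled to
the variance `1`. -/
theorem basisIntegral_eq_prod {Ω H ι : Type*} (Z : H → Ω → ℂ) (e : ι → H) {p q : ℕ}
    (j : Fin p → ι) (l : Fin q → ι) (ω : Ω) :
    basisIntegral Z e j l ω = ∏ k ∈ (multiIndex j).support ∪ (multiIndex l).support,
      complexHermite (multiIndex j k) (multiIndex l k) (Z (e k) ω) 1 := by
  set m := multiIndex j
  set n := multiIndex l
  have hm : multiFactorial m = ∏ k ∈ m.support ∪ n.support, (m k).factorial :=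
    Finsupp.prod_of_support_subset _ Finset.subset_union_left _ fun k _ => rfl
  have hn : multiFactorial n = ∏ k ∈ m.support ∪ n.support, (n k).factorial :=
    Finsupp.prod_of_support_subset _ Finset.subset_union_right _ fun k _ => rfl
  have hsqrt : Real.sqrt (multiFactorial m * multiFactorial n) =
      ∏ k ∈ m.support ∪ n.support, Real.sqrt ((m k).factorial * (n k).factorial) := by
    rw [hm, hn]
    push_cast
    rw [← Finset.prod_mul_distrib, Real.sqrt_prod _ fun k _ => by positivity]
  rw [basisIntegral, fourierHermite, hsqrt, Complex.ofReal_prod, ← Finset.prod_mul_distrib]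
  refine Finset.prod_congr rfl fun k _ => ?_
  have hs : Real.sqrt (2 ^ (m k + n k) * (m k).factorial * (n k).factorial) =
      Real.sqrt 2 ^ (m k + n k) * Real.sqrt ((m k).factorial * (n k).factorial) := by
    rw [mul_assoc, Real.sqrt_mul (by positivity), Real.sqrt_eq_rpow (2 ^ _),
      ← Real.rpow_natCast, ← Real.rpow_mul (by norm_num), mul_comm ((m k + n k : ℕ) : ℝ),
      Real.rpow_mul (by norm_num), Real.rpow_natCast, ← Real.sqrt_eq_rpow]
  have h2 : (Real.sqrt 2 : ℂ) ≠ 0 := by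
    rw [Complex.ofReal_ne_zero]
    positivity
  have hf : ((Real.sqrt ((m k).factorial * (n k).factorial) : ℝ) : ℂ) ≠ 0 := by
    rw [Complex.ofReal_ne_zero]
    positivity
  rw [complexHermite_sqrt_two_mul, hs, Complex.ofReal_mul, Complex.ofReal_pow]
  field_simp
  rfl

/-- A basis integral is the conditional expectation, given `Z`, of a holomorphic monomial in the
complexification of `(Z, conj Z)`. -/
theorem IsComplexIsonormal.basisIntegral_eq_integral {Ω : Type*} [MeasurableSpace Ω]
    {P : Measure Ω} {H : Type*} [NormedAddCommGroup H] [InnerProductSpace ℂ H] {Z : H → Ω → ℂ}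
    (hZ : IsComplexIsonormal Z P) {ι : Type*} {e : ι → H} (he : Orthonormal ℂ e) {p q : ℕ}
    (j : Fin p → ι) (l : Fin q → ι) (ω : Ω) :
    basisIntegral Z e j l ω = (Real.sqrt 2 : ℂ) ^ (p + q) *
      ∫ ω', ∏ i, complexify (withConj fun k => Z (e k)) (Sum.map j l i) (ω, ω') ∂P := by
  classical
  have hG := hZ.isStdComplexGaussian he
  set K := (multiIndex j).support ∪ (multiIndex l).support
  have h2 : (Real.sqrt 2 : ℂ) ≠ 0 := by
    rw [Complex.ofReal_ne_zero]
    positivity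
  have hprod : ∀ ω', ∏ i, complexify (withConj fun k => Z (e k)) (Sum.map j l i) (ω, ω') =
      ((Real.sqrt 2 : ℂ) ^ (p + q))⁻¹ * ∏ k : K,
        ((Z (e k) ω + Complex.I * Z (e k) ω') ^ multiIndex j k *
          (starRingEnd ℂ (Z (e k) ω) + Complex.I * starRingEnd ℂ (Z (e k) ω')) ^
            multiIndex l k) := by
    intro ω'
    rw [Fintype.prod_sum_type, Finset.prod_mul_distrib,
      Finset.prod_coe_sort K fun k => (Z (e k) ω + Complex.I * Z (e k) ω') ^ multiIndex j k,
      Finset.prod_coe_sort K fun k => (starRingEnd ℂ (Z (e k) ω) +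
        Complex.I * starRingEnd ℂ (Z (e k) ω')) ^ multiIndex l k,
      ← prod_comp_eq_prod_pow_multiIndex j (fun k => Z (e k) ω + Complex.I * Z (e k) ω')
        Finset.subset_union_left,
      ← prod_comp_eq_prod_pow_multiIndex l (fun k => starRingEnd ℂ (Z (e k) ω) +
        Complex.I * starRingEnd ℂ (Z (e k) ω')) Finset.subset_union_right]
    simp only [complexify, withConj, Sum.map_inl, Sum.map_inr, Sum.elim_inl, Sum.elim_inr,
      Finset.prod_mul_distrib, Finset.prod_const, Finset.card_univ, Fintype.card_fin]
    rw [inv_pow, inv_pow, pow_add, mul_inv]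
    ring
  simp_rw [hprod]
  rw [integral_const_mul, mul_inv_cancel_left₀ (pow_ne_zero _ h2), basisIntegral_eq_prod,
    (hG.comp_injective (φ := ((↑) : K → ι)) Subtype.val_injective).integral_prod_comp
      (f := fun k w => (Z (e k) ω + Complex.I * w) ^ multiIndex j k *
        (starRingEnd ℂ (Z (e k) ω) + Complex.I * starRingEnd ℂ w) ^ multiIndex l k)
      fun k => ((continuous_const.add (continuous_const.mul continuous_id)).pow _).mul
        ((continuous_const.add (continuous_const.mul Complex.continuous_conj)).pow _),
    ← Finset.prod_coe_sort]
  exact Finset.prod_congr rfl fun k _ => (hG.integral_wick (k : ι) _ _ _).symm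

/-! ### Moments of finite sums of basis integrals -/

section

variable {Ω : Type*} [MeasurableSpace Ω] {P : Measure Ω}
  {H : Type*} [NormedAddCommGroup H] [InnerProductSpace ℂ H] {Z : H → Ω → ℂ}

theorem hasAllMoments_basisIntegral (hZ : IsComplexIsonormal Z P) {ι : Type*} (e : ι → H) {p q : ℕ}
    (j : Fin p → ι) (l : Fin q → ι) : HasAllMoments (basisIntegral Z e j l) P := by
  classical
  have := hZ.isProbabilityMeasure
  have hall : ∀ k, HasAllMoments (Z (e k)) P := fun k r hr =>
    (hZ.isGaussianProcess.hasGaussianLaw_eval (e k)).memLp hr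
  have h : basisIntegral Z e j l = fun ω => _ := funext fun ω => basisIntegral_eq_prod Z e j l ω
  rw [h]
  refine HasAllMoments.prod _ fun k _ => HasAllMoments.sum _ fun r _ => ?_
  exact (((HasAllMoments.const _).mul ((hall k).pow _)).mul ((hall k).conj.pow _)).mul
    (HasAllMoments.const _)

/-- The moment bound for finite sums of basis integrals, uniform in the number of terms. By Jensen's
inequality the conditional expectation given `Z` can be dropped, which leaves the moments of a
homogeneous holomorphic polynomial of degree `p + q`. -/
theorem integral_norm_pow_sum_basisIntegral_le (hZ : IsComplexIsonormal Z P) {ι : Type*} {e : ι → H}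
    (he : Orthonormal ℂ e) {p q : ℕ} (S : Finset ((Fin p → ι) × (Fin q → ι)))
    (a : (Fin p → ι) × (Fin q → ι) → ℂ) (k : ℕ) :
    ∫ ω, ‖∑ x ∈ S, a x * basisIntegral Z e x.1 x.2 ω‖ ^ (2 * k) ∂P ≤
      ((p + q) * k).factorial * (2 ^ (p + q) * ∑ x ∈ S, ‖a x‖ ^ 2) ^ k := by
  have := hZ.isProbabilityMeasure
  have hG := (hZ.isStdComplexGaussian he).complexify_withConj
  set G := complexify (withConj fun k => Z (e k)) with hGdef
  let s : S → Fin p ⊕ Fin q → ι ⊕ ι := fun x => Sum.map x.1.1 x.1.2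
  have hs : Function.Injective s := by
    intro x y hxy
    refine Subtype.ext (Prod.ext (funext fun i => ?_) (funext fun i => ?_))
    · exact Sum.inl_injective (congrFun hxy (Sum.inl i))
    · exact Sum.inr_injective (congrFun hxy (Sum.inr i))
  set Q : Ω × Ω → ℂ := fun ω => ∑ x : S, a x * ∏ i, G (s x i) ω with hQ
  have hQm : HasAllMoments Q (P.prod P) :=
    HasAllMoments.sum _ fun x _ => (HasAllMoments.const _).mul (hG.hasAllMoments_prod (s x))
  have hQint : Integrable (fun ω => ‖Q ω‖ ^ (2 * k)) (P.prod P) :=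
    (hQm.pow (2 * k)).integrable.norm.congr (.of_forall fun ω => by simp)
  have hterm : ∀ᵐ ω ∂P, ∀ x : S, Integrable (fun ω' => ∏ i, G (s x i) (ω, ω')) P :=
    ae_all_iff.2 fun x => (hG.hasAllMoments_prod (s x)).integrable.prod_right_ae
  have hcond : ∀ᵐ ω ∂P, ∑ x ∈ S, a x * basisIntegral Z e x.1 x.2 ω =
      (Real.sqrt 2 : ℂ) ^ (p + q) * ∫ ω', Q (ω, ω') ∂P := by
    filter_upwards [hterm] with ω hω
    rw [hQ, integral_finsetSum _ fun x _ => (hω x).const_mul _, Finset.mul_sum,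
      ← Finset.sum_coe_sort S]
    refine Finset.sum_congr rfl fun x _ => ?_
    rw [integral_const_mul, hZ.basisIntegral_eq_integral he]
    ring
  have hjensen : ∀ᵐ ω ∂P, ‖∑ x ∈ S, a x * basisIntegral Z e x.1 x.2 ω‖ ^ (2 * k) ≤
      2 ^ ((p + q) * k) * ∫ ω', ‖Q (ω, ω')‖ ^ (2 * k) ∂P := by
    filter_upwards [hcond, hQint.prod_right_ae, hQm.integrable.prod_right_ae] with ω h1 h2 h3
    rw [h1, norm_mul, mul_pow]
    have h4 : ‖(Real.sqrt 2 : ℂ) ^ (p + q)‖ ^ (2 * k) = 2 ^ ((p + q) * k) := by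
      rw [norm_pow, Complex.norm_real, Real.norm_of_nonneg (Real.sqrt_nonneg 2), ← pow_mul,
        show (p + q) * (2 * k) = 2 * ((p + q) * k) by ring, pow_mul, Real.sq_sqrt (by norm_num)]
    rw [h4]
    gcongr
    calc ‖∫ ω', Q (ω, ω') ∂P‖ ^ (2 * k) ≤ (∫ ω', ‖Q (ω, ω')‖ ∂P) ^ (2 * k) := by
          gcongr
          exact norm_integral_le_integral_norm _
      _ ≤ ∫ ω', ‖Q (ω, ω')‖ ^ (2 * k) ∂P :=
          (convexOn_pow (2 * k)).map_integral_le (continuousOn_pow _) isClosed_Ici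
            (.of_forall fun ω' => norm_nonneg _) h3.norm h2
  calc ∫ ω, ‖∑ x ∈ S, a x * basisIntegral Z e x.1 x.2 ω‖ ^ (2 * k) ∂P
      ≤ ∫ ω, 2 ^ ((p + q) * k) * ∫ ω', ‖Q (ω, ω')‖ ^ (2 * k) ∂P ∂P :=
        integral_mono_of_nonneg (.of_forall fun ω => by positivity)
          (hQint.integral_prod_left.const_mul _) hjensen
    _ = 2 ^ ((p + q) * k) * ∫ ω, ‖Q ω‖ ^ (2 * k) ∂(P.prod P) := by
        rw [integral_const_mul, integral_prod _ hQint]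
    _ ≤ 2 ^ ((p + q) * k) * (((p + q) * k).factorial * (∑ x ∈ S, ‖a x‖ ^ 2) ^ k) := by
        gcongr
        have h := hG.integral_norm_pow_sum_le hs (fun x : S => a x) k
        rw [Fintype.card_sum, Fintype.card_fin, Fintype.card_fin,
          Finset.sum_coe_sort S fun x => ‖a x‖ ^ 2] at h
        exact h
    _ = _ := by
        rw [mul_pow, ← pow_mul]
        ring

end

/-! ### Elementary kernels over an orthonormal family -/

section

universe u

variable {H : Type u} [NormedAddCommGroup H] [InnerProductSpace ℂ H]

theorem inner_pureTensor (n : ℕ) (v w : Fin n → H) :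
    inner ℂ (pureTensor n v) (pureTensor n w) = ∏ i, inner ℂ (v i) (w i) := by
  induction n with
  | zero =>
    exact (EuclideanSpace.inner_single_left PUnit.unit (1 : ℂ)
      (EuclideanSpace.single PUnit.unit (1 : ℂ))).trans (by simp)
  | succ n ih =>
    rw [Fin.prod_univ_succ, ← ih]
    exact (UniformSpace.Completion.inner_coe _ _).trans (TensorProduct.inner_tmul _ _ _ _ _)

theorem inner_elemKernel {p q : ℕ} (v v' : Fin p → H) (w w' : Fin q → H) :
    inner ℂ (elemKernel v w) (elemKernel v' w') =
      (∏ i, inner ℂ (v i) (v' i)) * ∏ i, inner ℂ (w' i) (w i) := by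
  rw [elemKernel, elemKernel, UniformSpace.Completion.inner_coe, TensorProduct.inner_tmul,
    inner_pureTensor, inner_pureTensor]
  rfl

theorem orthonormal_elemKernel {ι : Type*} {e : ι → H} (he : Orthonormal ℂ e) (p q : ℕ) :
    Orthonormal ℂ fun x : (Fin p → ι) × (Fin q → ι) =>
      elemKernel (fun i => e (x.1 i)) fun i => e (x.2 i) := by
  classical
  rw [orthonormal_iff_ite] at he ⊢
  intro x y
  simp only [inner_elemKernel, he, Fintype.prod_boole]
  by_cases h : x = y
  · subst h
    simp
  · rw [if_neg h]
    by_cases h1 : ∀ i, x.1 i = y.1 i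
    · rw [if_neg fun h2 : ∀ i, y.2 i = x.2 i =>
        h (Prod.ext (funext h1) (funext fun i => (h2 i).symm)), mul_zero]
    · rw [if_neg h1, zero_mul]

end

/-! ### Moments of multiple integrals -/

section

variable {Ω : Type*} [MeasurableSpace Ω] {P : Measure Ω}
  {H : Type*} [NormedAddCommGroup H] [InnerProductSpace ℂ H] {Z : H → Ω → ℂ} {ι : Type*}

theorem coeFn_sum_smul_toLp_basisIntegral (hZ : IsComplexIsonormal Z P) (e : ι → H) {p q : ℕ}
    (S : Finset ((Fin p → ι) × (Fin q → ι))) (a : (Fin p → ι) × (Fin q → ι) → ℂ) :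
    (∑ x ∈ S, a x • (hZ.memLp_basisIntegral e x.1 x.2).toLp (basisIntegral Z e x.1 x.2) :
      Lp ℂ 2 P) =ᵐ[P] fun ω => ∑ x ∈ S, a x * basisIntegral Z e x.1 x.2 ω := by
  have h1 := Lp.coeFn_finsetSum S fun x =>
    a x • (hZ.memLp_basisIntegral e x.1 x.2).toLp (basisIntegral Z e x.1 x.2)
  have h2 : ∀ᵐ ω ∂P, ∀ x : S, (a x • (hZ.memLp_basisIntegral e x.1.1 x.1.2).toLp
      (basisIntegral Z e x.1.1 x.1.2) : Lp ℂ 2 P) ω = a x * basisIntegral Z e x.1.1 x.1.2 ω := by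
    refine ae_all_iff.2 fun x => ?_
    filter_upwards [Lp.coeFn_smul (a x) ((hZ.memLp_basisIntegral e x.1.1 x.1.2).toLp _),
      (hZ.memLp_basisIntegral e x.1.1 x.1.2).coeFn_toLp] with ω h3 h4
    rw [h3, Pi.smul_apply, h4, smul_eq_mul]
  filter_upwards [h1, h2] with ω h3 h4
  rw [h3, Finset.sum_apply]
  exact Finset.sum_congr rfl fun x hx => h4 ⟨x, hx⟩

theorem norm_sq_sum_smul_toLp_le (hZ : IsComplexIsonormal Z P) {e : ι → H} (he : Orthonormal ℂ e)
    {p q : ℕ} (S : Finset ((Fin p → ι) × (Fin q → ι))) (a : (Fin p → ι) × (Fin q → ι) → ℂ) :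
    ‖(∑ x ∈ S, a x • (hZ.memLp_basisIntegral e x.1 x.2).toLp (basisIntegral Z e x.1 x.2) :
      Lp ℂ 2 P)‖ ^ 2 ≤ (p + q).factorial * (2 ^ (p + q) * ∑ x ∈ S, ‖a x‖ ^ 2) := by
  have h := integral_norm_pow_sum_basisIntegral_le hZ he S a 1
  rw [mul_one, mul_one, pow_one] at h
  refine le_trans (le_of_eq ?_) h
  set F := (∑ x ∈ S, a x • (hZ.memLp_basisIntegral e x.1 x.2).toLp (basisIntegral Z e x.1 x.2) :
      Lp ℂ 2 P) with hF
  have h1 : ((‖F‖ ^ 2 : ℝ) : ℂ) = ((∫ ω, ‖F ω‖ ^ 2 ∂P : ℝ) : ℂ) := by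
    have h2 := inner_self_eq_norm_sq_to_K (𝕜 := ℂ) F
    rw [L2.inner_def] at h2
    rw [← integral_complex_ofReal]
    push_cast
    refine Eq.trans h2.symm (integral_congr_ae (.of_forall fun ω => ?_))
    exact inner_self_eq_norm_sq_to_K (𝕜 := ℂ) (F ω)
  rw [Complex.ofReal_inj.1 h1]
  refine integral_congr_ae ?_
  filter_upwards [coeFn_sum_smul_toLp_basisIntegral hZ e S a] with ω hω
  rw [hω]

/-- The series defining the multiple integral converges in `L²`. -/
theorem summable_multipleIntegral (hZ : IsComplexIsonormal Z P) {e : ι → H} (he : Orthonormal ℂ e)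
    {p q : ℕ} (f : KernelSpace H p q) :
    Summable fun x : (Fin p → ι) × (Fin q → ι) =>
      (inner ℂ (elemKernel (fun i => e (x.1 i)) fun i => e (x.2 i)) f : ℂ) •
        (hZ.memLp_basisIntegral e x.1 x.2).toLp (basisIntegral Z e x.1 x.2) := by
  have hsum := (orthonormal_elemKernel he p q).inner_products_summable f
  rw [summable_iff_vanishing_norm] at hsum ⊢
  intro ε hε
  obtain ⟨S, hS⟩ := hsum (ε ^ 2 / ((p + q).factorial * 2 ^ (p + q))) (by positivity)
  refine ⟨S, fun T hT => ?_⟩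
  have h := hS T hT
  rw [Real.norm_of_nonneg (Finset.sum_nonneg fun x _ => by positivity),
    lt_div_iff₀ (by positivity)] at h
  refine lt_of_pow_lt_pow_left₀ 2 hε.le ((norm_sq_sum_smul_toLp_le hZ he T _).trans_lt ?_)
  linarith

/-- The moment bound for multiple integrals, with `‖f‖` in place of the `L²` norm of the integral:
Fatou's lemma along partial sums, whose coefficients are controlled by Bessel's inequality. -/
theorem lintegral_norm_multipleIntegral_pow_le (hZ : IsComplexIsonormal Z P)
    (e : HilbertBasis ι ℂ H) {p q : ℕ} (f : KernelSpace H p q) (k : ℕ) :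
    ∫⁻ ω, ENNReal.ofReal (‖multipleIntegral hZ e f ω‖ ^ (2 * k)) ∂P ≤
      ENNReal.ofReal (((p + q) * k).factorial * (2 ^ (p + q) * ‖f‖ ^ 2) ^ k) := by
  have := hZ.isProbabilityMeasure
  have he := e.orthonormal
  have hsum := (summable_multipleIntegral hZ he f).hasSum
  set a : (Fin p → ι) × (Fin q → ι) → ℂ :=
    fun x => inner ℂ (elemKernel (fun i => e (x.1 i)) fun i => e (x.2 i)) f with ha
  set F : Finset ((Fin p → ι) × (Fin q → ι)) → Lp ℂ 2 P := fun S =>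
    ∑ x ∈ S, a x • (hZ.memLp_basisIntegral e x.1 x.2).toLp (basisIntegral Z e x.1 x.2) with hF
  have hlim : Filter.Tendsto F Filter.atTop (nhds (multipleIntegral hZ e f)) := hsum
  have hseq : ∃ S : ℕ → Finset ((Fin p → ι) × (Fin q → ι)),
      Filter.Tendsto (fun n => F (S n)) Filter.atTop (nhds (multipleIntegral hZ e f)) := by
    have h : ∀ n : ℕ, ∃ S, dist (F S) (multipleIntegral hZ e f) < 1 / ((n : ℝ) + 1) := fun n =>
      ((Metric.tendsto_nhds.1 hlim) _ (by positivity)).exists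
    choose S hS using h
    refine ⟨S, tendsto_iff_dist_tendsto_zero.2 (squeeze_zero (fun _ => dist_nonneg)
      (fun n => (hS n).le) tendsto_one_div_add_atTop_nhds_zero_nat)⟩
  obtain ⟨S, hS⟩ := hseq
  obtain ⟨φ, -, hφ⟩ := (tendstoInMeasure_of_tendsto_Lp hS).exists_seq_tendsto_ae
  have hbound : ∀ S, ∫⁻ ω, ENNReal.ofReal (‖F S ω‖ ^ (2 * k)) ∂P ≤
      ENNReal.ofReal (((p + q) * k).factorial * (2 ^ (p + q) * ‖f‖ ^ 2) ^ k) := by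
    intro S
    have hint : Integrable
        (fun ω => ‖∑ x ∈ S, a x * basisIntegral Z e x.1 x.2 ω‖ ^ (2 * k)) P := by
      have hall : HasAllMoments (fun ω => ∑ x ∈ S, a x * basisIntegral Z e x.1 x.2 ω) P :=
        HasAllMoments.sum _ fun x _ =>
          (HasAllMoments.const _).mul (hasAllMoments_basisIntegral hZ e x.1 x.2)
      exact (hall.pow (2 * k)).integrable.norm.congr (.of_forall fun ω => by simp)
    have hae : (fun ω => ENNReal.ofReal (‖F S ω‖ ^ (2 * k))) =ᵐ[P] fun ω =>
        ENNReal.ofReal (‖∑ x ∈ S, a x * basisIntegral Z e x.1 x.2 ω‖ ^ (2 * k)) := by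
      filter_upwards [coeFn_sum_smul_toLp_basisIntegral hZ e S a] with ω hω
      rw [hF]
      simp only
      rw [hω]
    rw [lintegral_congr_ae hae, ← ofReal_integral_eq_lintegral_ofReal hint
      (.of_forall fun ω => by positivity)]
    refine ENNReal.ofReal_le_ofReal
      ((integral_norm_pow_sum_basisIntegral_le hZ he S a k).trans ?_)
    gcongr
    exact (orthonormal_elemKernel he p q).sum_inner_products_le f
  have hpt : (fun ω => ENNReal.ofReal (‖multipleIntegral hZ e f ω‖ ^ (2 * k))) =ᵐ[P] fun ω =>
      Filter.liminf (fun n => ENNReal.ofReal (‖F (S (φ n)) ω‖ ^ (2 * k))) Filter.atTop := by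
    filter_upwards [hφ] with ω hω
    exact (ENNReal.tendsto_ofReal (hω.norm.pow (2 * k))).liminf_eq.symm
  rw [lintegral_congr_ae hpt]
  refine (lintegral_liminf_le' fun n => ?_).trans ?_
  · exact ((Lp.aestronglyMeasurable _).norm.aemeasurable.pow_const _).ennreal_ofReal
  · refine Filter.liminf_le_of_le (by isBoundedDefault) fun b hb => ?_
    obtain ⟨n, hn⟩ := hb.exists
    exact hn.trans (hbound _)

end

/-! ### From moments to exponential integrability -/

/-- If `E[X^{2m}] ≤ (nm)! A^m` for all `m`, then `Y = X^{2/n}` satisfies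
`E[Y^m] ≤ E[Y^{nm}]^{1/n} ≤ m! (e n A^{1/n})^m`, and the exponential series converges. -/
theorem exists_integrable_exp_mul_rpow {Ω : Type*} [MeasurableSpace Ω] {P : Measure Ω}
    [IsProbabilityMeasure P] {X : Ω → ℝ} (hX : AEMeasurable X P) (hX0 : ∀ ω, 0 ≤ X ω) {n : ℕ}
    (hn : 0 < n) {A : ℝ} (hA : 0 < A)
    (hmom : ∀ m : ℕ, ∫⁻ ω, ENNReal.ofReal (X ω ^ (2 * m)) ∂P ≤
      ENNReal.ofReal ((n * m).factorial * A ^ m)) :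
    ∃ c₀ : ℝ, 0 < c₀ ∧ ∀ c : ℝ, c ≤ c₀ →
      Integrable (fun ω => Real.exp (c * X ω ^ ((2 : ℝ) / n))) P := by
  have hn' : (n : ℝ) ≠ 0 := by positivity
  set B : ℝ := n * Real.exp 1 * A ^ (1 / n : ℝ) with hB
  have hBpos : 0 < B := by positivity
  set Y : Ω → ℝ := fun ω => X ω ^ ((2 : ℝ) / n) with hY
  have hY0 : ∀ ω, 0 ≤ Y ω := fun ω => Real.rpow_nonneg (hX0 ω) _
  have hYm : AEMeasurable Y P := hX.pow_const _
  have hYn : ∀ ω m, (Y ω ^ m) ^ n = X ω ^ (2 * m) := by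
    intro ω m
    rw [hY, ← pow_mul, ← Real.rpow_natCast, ← Real.rpow_mul (hX0 ω), ← Real.rpow_natCast]
    congr 1
    push_cast
    field_simp
  have hfac : ∀ m : ℕ, ((n * m).factorial : ℝ) * A ^ m ≤ (m.factorial * B ^ m) ^ n := by
    intro m
    have h1 : ((n * m).factorial : ℝ) ≤ ((n : ℝ) * m) ^ (n * m) := by
      exact_mod_cast Nat.factorial_le_pow (n * m)
    have h2 : (m : ℝ) ^ m ≤ m.factorial * Real.exp 1 ^ m := by
      have := Real.pow_div_factorial_le_exp (m : ℝ) (by positivity) m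
      rw [div_le_iff₀ (by positivity)] at this
      rw [← Real.exp_nat_mul, mul_one, mul_comm]
      exact this
    have h3 : (A ^ (1 / n : ℝ)) ^ n = A := by
      rw [← Real.rpow_natCast, ← Real.rpow_mul hA.le, one_div_mul_cancel hn', Real.rpow_one]
    calc ((n * m).factorial : ℝ) * A ^ m ≤ ((n : ℝ) * m) ^ (n * m) * A ^ m := by gcongr
      _ = ((m : ℝ) ^ m) ^ n * ((n : ℝ) ^ m) ^ n * A ^ m := by
          rw [mul_pow, mul_comm n m, pow_mul, pow_mul]
          ring
      _ ≤ (m.factorial * Real.exp 1 ^ m) ^ n * ((n : ℝ) ^ m) ^ n * A ^ m := by gcongr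
      _ = (m.factorial * B ^ m) ^ n := by
          conv_lhs => rw [← h3]
          rw [hB]
          ring
  have hYmom : ∀ m : ℕ, ∫⁻ ω, ENNReal.ofReal (Y ω ^ m) ∂P ≤
      ENNReal.ofReal (m.factorial * B ^ m) := by
    intro m
    have h1 : (∫⁻ ω, ENNReal.ofReal (Y ω ^ m) ∂P) ^ n ≤
        ∫⁻ ω, ENNReal.ofReal (Y ω ^ m) ^ n ∂P := by
      have h := eLpNorm'_le_eLpNorm'_of_exponent_le (μ := P) one_pos
        (show (1 : ℝ) ≤ n by exact_mod_cast hn)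
        (hYm.pow_const m).ennreal_ofReal.aestronglyMeasurable
      simp only [eLpNorm', enorm_eq_self, ENNReal.rpow_one, div_one, ENNReal.rpow_natCast] at h
      refine (pow_le_pow_left' h n).trans_eq ?_
      rw [← ENNReal.rpow_natCast, ← ENNReal.rpow_mul, one_div_mul_cancel hn', ENNReal.rpow_one]
    have h2 : ∫⁻ ω, ENNReal.ofReal (Y ω ^ m) ^ n ∂P =
        ∫⁻ ω, ENNReal.ofReal (X ω ^ (2 * m)) ∂P := by
      refine lintegral_congr fun ω => ?_
      rw [← ENNReal.ofReal_pow (pow_nonneg (hY0 ω) m), hYn]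
    have h3 := (h1.trans_eq h2).trans ((hmom m).trans (ENNReal.ofReal_le_ofReal (hfac m)))
    rw [ENNReal.ofReal_pow (by positivity)] at h3
    exact (ENNReal.pow_le_pow_left_iff hn.ne').1 h3
  -- This choice bounds the mean of the `m`-th term of the exponential series by `2 ^ (-m)`.
  refine ⟨1 / (2 * B), by positivity, fun c hc => ?_⟩
  have hmeas : ∀ c : ℝ, AEStronglyMeasurable (fun ω => Real.exp (c * Y ω)) P := fun c =>
    (Real.measurable_exp.comp_aemeasurable (hYm.const_mul c)).aestronglyMeasurable
  have hmain : Integrable (fun ω => Real.exp (1 / (2 * B) * Y ω)) P := by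
    refine ⟨hmeas _, ?_⟩
    rw [hasFiniteIntegral_iff_ofReal (.of_forall fun ω => (Real.exp_pos _).le)]
    have hexp : ∀ ω, ENNReal.ofReal (Real.exp (1 / (2 * B) * Y ω)) =
        ∑' m : ℕ, ENNReal.ofReal ((1 / (2 * B)) ^ m / m.factorial) * ENNReal.ofReal (Y ω ^ m) := by
      intro ω
      have hx : 0 ≤ 1 / (2 * B) * Y ω := mul_nonneg (by positivity) (hY0 ω)
      have hs := NormedSpace.expSeries_div_hasSum_exp (1 / (2 * B) * Y ω)
      rw [← Real.exp_eq_exp_ℝ] at hs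
      rw [← hs.tsum_eq, ENNReal.ofReal_tsum_of_nonneg (fun m => by positivity) hs.summable]
      refine tsum_congr fun m => ?_
      rw [← ENNReal.ofReal_mul (by positivity), mul_pow]
      congr 1
      ring
    simp_rw [hexp]
    rw [lintegral_tsum fun m => (hYm.pow_const m).ennreal_ofReal.const_mul _]
    have hle : ∀ m : ℕ, ∫⁻ ω, ENNReal.ofReal ((1 / (2 * B)) ^ m / m.factorial) *
        ENNReal.ofReal (Y ω ^ m) ∂P ≤ ENNReal.ofReal ((1 / 2) ^ m) := by
      intro m
      rw [lintegral_const_mul' _ _ ENNReal.ofReal_ne_top]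
      refine (mul_le_mul_right (hYmom m) _).trans_eq ?_
      rw [← ENNReal.ofReal_mul (by positivity)]
      congr 1
      have : ((1 / (2 * B)) ^ m) = (1 / 2) ^ m * (B ^ m)⁻¹ := by
        rw [one_div, mul_inv, mul_pow, inv_pow B, one_div]
      rw [this]
      field_simp
    refine (ENNReal.tsum_le_tsum hle).trans_lt ?_
    rw [← ENNReal.ofReal_tsum_of_nonneg (fun m => by positivity) summable_geometric_two]
    exact ENNReal.ofReal_lt_top
  refine hmain.mono' (hmeas c) (.of_forall fun ω => ?_)
  rw [Real.norm_of_nonneg (Real.exp_pos _).le]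
  exact Real.exp_le_exp.2 (mul_le_mul_of_nonneg_right hc (hY0 ω))

end WienerIto
end

theorem mainTheorem10 {Ω : Type*} [MeasurableSpace Ω] (P : MeasureTheory.Measure Ω)
    [MeasureTheory.IsProbabilityMeasure P]
    {H : Type*} [NormedAddCommGroup H] [InnerProductSpace ℂ H] [CompleteSpace H]
    [TopologicalSpace.SeparableSpace H]
    (Z : H → Ω → ℂ) (hZ : WienerIto.IsComplexIsonormal Z P)
    {ι : Type*} (e : HilbertBasis ι ℂ H)
    (p q : ℕ) (hpq : 0 < p + q) (f : WienerIto.KernelSpace H p q) :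
    ∃ c₀ : ℝ, 0 < c₀ ∧ ∀ c : ℝ, c ≤ c₀ →
      MeasureTheory.Integrable
        (fun ω => Real.exp (c * ‖WienerIto.multipleIntegral hZ e f ω‖ ^ ((2 : ℝ) / ((p : ℝ) + q))))
        P := by
  -- The summand `1` keeps the constant positive if `f = 0`.
  have h := WienerIto.exists_integrable_exp_mul_rpow
    (MeasureTheory.Lp.aestronglyMeasurable (WienerIto.multipleIntegral hZ e f)).norm.aemeasurable
    (fun ω => norm_nonneg _) hpq (A := 2 ^ (p + q) * ‖f‖ ^ 2 + 1) (by positivity) fun m =>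
      (WienerIto.lintegral_norm_multipleIntegral_pow_le hZ e f m).trans
        (ENNReal.ofReal_le_ofReal (by gcongr; linarith))
  simpa only [Nat.cast_add] using h
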